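/- Let $\mathbb{L}^3$ be Lorentz–Minkowski space with coordinates $(t,x,y)$ and metric $-dt^2+dx^2+dy^2$. A surface is spacelike, timelike or lightlike at a point if its first fundamental form there is positive definite, Lorentzian or degenerate, respectively. Let $\Omega\subset\mathbb{R}^2$ be a domain containing $o=(0,0)$, and let $g:\Omega\to\mathbb{R}$ be a real analytic solution of the zero mean curvature equation $$(1-g_y^2)g_{xx}+2g_xg_yg_{xy}+(1-g_x^2)g_{yy}=0$$ with $g(o)=0$, such that the graph $t=g(x,y)$ is lightlike at $o$ and $\nabla B_g(o)=0$, where $B_g=1-g_x^2-g_y^2$. Assume that $g$ is even (resp. odd) in $x$. By the Wick rotation of $g$ with respect to $x$ we mean a real analytic function $h(t,x)$ on a domain $\Omega'\ni o$ which near $o$ equals $g(ix,t)$ (resp. $-i\,g(it,x)$), where $g$ on the right-hand side denotes the holomorphic extension of $g$ to a neighbourhood of $o$ in $\mathbb{C}^2$; its graph in $\mathbb{L}^3$ is the surface $y=h(t,x)$. Such a real Wick rotation $h$ exists (on some $\Omega'$), and there is $\sigma\in\{1,-1\}$ with the following properties. Let $J\ni 0$ be any open interval with $S:=\{0\}\times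 J\subset\Omega$ (resp. $S:=J\times\{0\}\subset\Omega$), let $(\Omega',h)$ be any Wick rotation of $g$, and let $J'\ni0$ be any open interval with $S':=J'\times\{0\}\subset\Omega'$. 1. On $S$ we have $g(0,s)=\sigma s$ (resp. $g(s,0)=\sigma s$) and the graph of $g$ is lightlike at every point of $S$; likewise $h(s,0)=\sigma s$ for $s\in J'$ and the graph of $h$ is lightlike at every point of $S'$. Thus both graphs contain a lightlike line segment, $L$ over $S$ and $L'$ over $S'$. 2. Let $\alpha_g(s)=\sigma g_{xx}(0,s)$ (resp. $\alpha_g(s)=\sigma g_{yy}(s,0)$), $s\in J$, be the approximation function of $g$ along $L$. Suppose that $g$ is neither of type $\alpha^0_{\mathrm I}$ along $L$ (that is, $\alpha_g\equiv0$ on $J$) nor of type $\alpha^0_{\mathrm{II}}$ (that is, $\alpha_g(s)=(s+c)^{-1}$ on $J$ for some constant $c\neq0$). Then the Wick rotation preserves (resp. reverses) the causal character near the lightlike lines: either the graph of $g$ is spacelike on both sides of $L$ and the graph of $h$ is spacelike (resp. timelike) on both sides of $L'$, or the graph of $g$ is timelike on both sides of $L$ and the graph of $h$ is timelike (resp. spacelike)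 on both sides of $L'$. Here a property holds on both sides of $L$ (or $L'$) if it holds at all points of $U\setminus S$ (or $U\setminus S'$) for some open neighbourhood $U$ of $S$ in $\Omega$ (or of $S'$ in $\Omega'$). -/

import Mathlib

open Topology

/-- The Lorentz-Minkowski metric `-dt² + dx² + dy²` on `𝕃³`; a point of `𝕃³` is a triple
`(t, x, y)`. -/
def lorentz (u v : ℝ × ℝ × ℝ) : ℝ :=
  -(u.1 * v.1) + u.2.1 * v.2.1 + u.2.2 * v.2.2

/-- First fundamental form `X^*⟨ , ⟩` at `p` of a parametrized surface `X` in `𝕃³`. -/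
noncomputable def firstForm (X : ℝ × ℝ → ℝ × ℝ × ℝ) (p v w : ℝ × ℝ) : ℝ :=
  lorentz (fderiv ℝ X p v) (fderiv ℝ X p w)

/-- The first fundamental form at `p` is Riemannian (positive definite). -/
def IsSpacelikeAt (X : ℝ × ℝ → ℝ × ℝ × ℝ) (p : ℝ × ℝ) : Prop :=
  ∀ v : ℝ × ℝ, v ≠ 0 → 0 < firstForm X p v v

/-- The first fundamental form at `p` is Lorentzian: a symmetric bilinear form on a plane has
signature `(1, 1)` exactly if it takes a negative and a positive value on the diagonal. -/
def IsTimelikeAt (X : ℝ × ℝ → ℝ × ℝ × ℝ) (p : ℝ × ℝ) : Prop :=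
  (∃ v : ℝ × ℝ, firstForm X p v v < 0) ∧ ∃ w : ℝ × ℝ, 0 < firstForm X p w w

/-- The first fundamental form at `p` is degenerate. -/
def IsLightlikeAt (X : ℝ × ℝ → ℝ × ℝ × ℝ) (p : ℝ × ℝ) : Prop :=
  ∃ v : ℝ × ℝ, v ≠ 0 ∧ ∀ w : ℝ × ℝ, firstForm X p v w = 0

/-- The graph `t = g(x, y)` over the spacelike `xy`-plane, parametrized by `(x, y)`. -/
def graphXY (g : ℝ × ℝ → ℝ) (p : ℝ × ℝ) : ℝ × ℝ × ℝ := (g p, p.1, p.2)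

/-- The graph `y = h(t, x)` over the timelike `tx`-plane, parametrized by `(t, x)`. -/
def graphTX (h : ℝ × ℝ → ℝ) (q : ℝ × ℝ) : ℝ × ℝ × ℝ := (q.1, q.2, h q)

/-- Partial derivative in the first variable. -/
noncomputable def partial₁ (f : ℝ × ℝ → ℝ) (p : ℝ × ℝ) : ℝ := fderiv ℝ f p (1, 0)

/-- Partial derivative in the second variable. -/
noncomputable def partial₂ (f : ℝ × ℝ → ℝ) (p : ℝ × ℝ) : ℝ := fderiv ℝ f p (0, 1)

/-- The zero mean curvature equation
`(1 - g_y²) g_xx + 2 g_x g_y g_xy + (1 - g_x²) g_yy = 0` at the point `p`. -/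
def SatisfiesZMC (g : ℝ × ℝ → ℝ) (p : ℝ × ℝ) : Prop :=
  (1 - partial₂ g p ^ 2) * partial₁ (partial₁ g) p
    + 2 * partial₁ g p * partial₂ g p * partial₂ (partial₁ g) p
    + (1 - partial₁ g p ^ 2) * partial₂ (partial₂ g) p = 0

/-- The function `B_g = 1 - g_x² - g_y²`. -/
noncomputable def lightFun (g : ℝ × ℝ → ℝ) (p : ℝ × ℝ) : ℝ :=
  1 - partial₁ g p ^ 2 - partial₂ g p ^ 2

/-- `t = g(x, y)` is a real analytic zero mean curvature graph over the domain `Ω`, passing through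
the origin, for which `o = (0, 0)` is a lightlike point with `∇B_g(o) = 0`. -/
structure IsDegenerateZMCGraph (Ω : Set (ℝ × ℝ)) (g : ℝ × ℝ → ℝ) : Prop where
  isOpen : IsOpen Ω
  isConnected : IsConnected Ω
  zero_mem : (0, 0) ∈ Ω
  analytic : AnalyticOnNhd ℝ g Ω
  zmc : ∀ p ∈ Ω, SatisfiesZMC g p
  map_zero : g (0, 0) = 0
  lightlike : IsLightlikeAt (graphXY g) (0, 0)
  grad_eq_zero : fderiv ℝ (lightFun g) (0, 0) = 0

/-- `g` is even with respect to the `x`-axis, i.e. in the variable `x`. -/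
def IsEvenInX (Ω : Set (ℝ × ℝ)) (g : ℝ × ℝ → ℝ) : Prop :=
  ∀ x y : ℝ, (x, y) ∈ Ω → (-x, y) ∈ Ω → g (-x, y) = g (x, y)

/-- `g` is odd with respect to the `x`-axis, i.e. in the variable `x`. -/
def IsOddInX (Ω : Set (ℝ × ℝ)) (g : ℝ × ℝ → ℝ) : Prop :=
  ∀ x y : ℝ, (x, y) ∈ Ω → (-x, y) ∈ Ω → g (-x, y) = -g (x, y)

/-- The real analytic function `h` on the domain `Ω' ∋ o` of the `tx`-plane is the Wick rotation
`h(t, x) = g(ix, t)`. Here `G` is the holomorphic extension of `g` near `o`. The germ of `h` at `o`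
is thereby determined, and `h` on the connected set `Ω'` is the analytic continuation of this
germ. -/
structure IsEvenWickRotation (g : ℝ × ℝ → ℝ) (Ω' : Set (ℝ × ℝ)) (h : ℝ × ℝ → ℝ) : Prop where
  isOpen : IsOpen Ω'
  isConnected : IsConnected Ω'
  zero_mem : (0, 0) ∈ Ω'
  analytic : AnalyticOnNhd ℝ h Ω'
  rotation : ∃ G : ℂ × ℂ → ℂ, AnalyticAt ℂ G (0, 0) ∧
    (∀ᶠ p : ℝ × ℝ in 𝓝 (0, 0), G ((p.1 : ℂ), (p.2 : ℂ)) = (g p : ℂ)) ∧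
    ∀ᶠ q : ℝ × ℝ in 𝓝 (0, 0), (h q : ℂ) = G (Complex.I * (q.2 : ℂ), (q.1 : ℂ))

/-- The real analytic function `h` on the domain `Ω' ∋ o` of the `tx`-plane is the Wick rotation
`h(t, x) = -i g(it, x)`, in the same sense as in the even case. -/
structure IsOddWickRotation (g : ℝ × ℝ → ℝ) (Ω' : Set (ℝ × ℝ)) (h : ℝ × ℝ → ℝ) : Prop where
  isOpen : IsOpen Ω'
  isConnected : IsConnected Ω'
  zero_mem : (0, 0) ∈ Ω'
  analytic : AnalyticOnNhd ℝ h Ω'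
  rotation : ∃ G : ℂ × ℂ → ℂ, AnalyticAt ℂ G (0, 0) ∧
    (∀ᶠ p : ℝ × ℝ in 𝓝 (0, 0), G ((p.1 : ℂ), (p.2 : ℂ)) = (g p : ℂ)) ∧
    ∀ᶠ q : ℝ × ℝ in 𝓝 (0, 0), (h q : ℂ) = -Complex.I * G (Complex.I * (q.1 : ℂ), (q.2 : ℂ))

/-- `J` is an open interval around `0`. -/
def IsIntervalAroundZero (J : Set ℝ) : Prop :=
  IsOpen J ∧ IsPreconnected J ∧ (0 : ℝ) ∈ J

/-- The approximation function `α_g(y) = g_xx(0, y)` of a graph `t = g(x, y)` containing the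
lightlike segment `t = σy, x = 0`, `σ = ±1`. The factor `σ` is the reflection `t ↦ -t` that moves
the segment into `{(y, 0, y)}` if `σ = -1`. -/
noncomputable def approxAlongY (g : ℝ × ℝ → ℝ) (σ y : ℝ) : ℝ :=
  σ * partial₁ (partial₁ g) (0, y)

/-- The approximation function `α_g(x) = g_yy(x, 0)` of a graph `t = g(x, y)` containing the
lightlike segment `t = σx, y = 0`, `σ = ±1`, with the same normalization. -/
noncomputable def approxAlongX (g : ℝ × ℝ → ℝ) (σ x : ℝ) : ℝ :=
  σ * partial₂ (partial₂ g) (x, 0)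

/-- Type `α⁰_I` along the segment over `J`: the approximation function is `0`. -/
def IsTypeZeroI (J : Set ℝ) (α : ℝ → ℝ) : Prop := ∀ s ∈ J, α s = 0

/-- Type `α⁰_II` along the segment over `J`: the approximation function is `(s + c)⁻¹`, `c ≠ 0`. -/
def IsTypeZeroII (J : Set ℝ) (α : ℝ → ℝ) : Prop :=
  ∃ c : ℝ, c ≠ 0 ∧ ∀ s ∈ J, s + c ≠ 0 ∧ α s = (s + c)⁻¹

/-- `P` holds on both sides of the segment `S ⊆ Ω`, i.e. at all points of `U \ S` for some open
neighbourhood `U` of `S` in `Ω`. -/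
def NearBothSides (Ω S : Set (ℝ × ℝ)) (P : ℝ × ℝ → Prop) : Prop :=
  ∃ U : Set (ℝ × ℝ), IsOpen U ∧ S ⊆ U ∧ U ⊆ Ω ∧ ∀ p ∈ U \ S, P p

/-! ### Partial derivatives of functions of two variables -/

/-! After exchanging x and y in the even case, both cases share one normal form: a zero mean
curvature graph f(s, n) with f_s = σ = ±1, f_n = 0 and f_sn = 0 at o. Parity kills one first
derivative, B = 0 fixes the other up to sign, and ∇B = 0 then gives f_sn = 0.

On n = 0 the equation and its n-derivative can be solved for f_ss and f_ssn, so (1 - f_s², f_n,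
f_sn) solves a linear homogeneous ODE with zero initial value (`eventually_line`). Hence f_s = σ and
f_n = 0 on the axis near o, and on the whole segment by analyticity; this is the lightlike line. Put
α = σ f_nn there. Then B = B_n = 0 and B_nn = -2(α' + α²), while the second n-derivative of the
equation reads α'' + 2αα' = 0. So B_nn is a constant κ (`partial₂₂_lightFun_const`). If κ = 0, the
Riccati equation α' + α² = 0 leaves only the two excluded types (`isTypeZero_of_riccati`); if κ ≠ 0,
B has the sign of κ on both sides of the line.

Both Wick rotations have the form h(t, x) = c F(at, bx) with ca = 1 and (cb)² = -1, where F extends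
f holomorphically. The discriminant h_t² - 1 - h_x² of the graph y = h is then -B(at, bx), and by
the identity theorem its second x-derivative along L' is the constant -b²κ (`rotation_lightFun`).
This is κ in the even case (b = i) and -κ in the odd case (b = 1). For both kinds of graph a
positive discriminant means spacelike and a negative one timelike, whence preservation or reversal.

A real rotation exists because the complexified power series commutes with conjugation and can be
given the parity of g, which together make c F(at, bx) real. -/

lemma AnalyticAt.partial₁ {f : ℝ × ℝ → ℝ} {p : ℝ × ℝ} (hf : AnalyticAt ℝ f p) :
    AnalyticAt ℝ (partial₁ f) p :=
  ((ContinuousLinearMap.apply ℝ ℝ ((1, 0) : ℝ × ℝ)).analyticAt _).comp hf.fderiv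

lemma AnalyticAt.partial₂ {f : ℝ × ℝ → ℝ} {p : ℝ × ℝ} (hf : AnalyticAt ℝ f p) :
    AnalyticAt ℝ (partial₂ f) p :=
  ((ContinuousLinearMap.apply ℝ ℝ ((0, 1) : ℝ × ℝ)).analyticAt _).comp hf.fderiv

lemma fderiv_apply_eq_partial (f : ℝ × ℝ → ℝ) (p v : ℝ × ℝ) :
    fderiv ℝ f p v = v.1 * partial₁ f p + v.2 * partial₂ f p := by
  have : v = v.1 • ((1, 0) : ℝ × ℝ) + v.2 • ((0, 1) : ℝ × ℝ) := by ext <;> simp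
  conv_lhs => rw [this]
  simp only [map_add, map_smul, smul_eq_mul, partial₁, partial₂]

lemma DifferentiableAt.hasDerivAt_partial₁ {f : ℝ × ℝ → ℝ} {s n : ℝ}
    (hf : DifferentiableAt ℝ f (s, n)) :
    HasDerivAt (fun s => f (s, n)) (_root_.partial₁ f (s, n)) s :=
  HasFDerivAt.comp_hasDerivAt (f := fun s : ℝ => (s, n)) s hf.hasFDerivAt
    ((hasDerivAt_id s).prodMk (hasDerivAt_const s n))

lemma DifferentiableAt.hasDerivAt_partial₂ {f : ℝ × ℝ → ℝ} {s n : ℝ}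
    (hf : DifferentiableAt ℝ f (s, n)) :
    HasDerivAt (fun n => f (s, n)) (_root_.partial₂ f (s, n)) n :=
  HasFDerivAt.comp_hasDerivAt (f := fun n : ℝ => (s, n)) n hf.hasFDerivAt
    ((hasDerivAt_const n s).prodMk (hasDerivAt_id n))

lemma AnalyticAt.hasDerivAt_partial₁ {f : ℝ × ℝ → ℝ} {s n : ℝ} (hf : AnalyticAt ℝ f (s, n)) :
    HasDerivAt (fun s => f (s, n)) (_root_.partial₁ f (s, n)) s :=
  hf.differentiableAt.hasDerivAt_partial₁

lemma AnalyticAt.hasDerivAt_partial₂ {f : ℝ × ℝ → ℝ} {s n : ℝ} (hf : AnalyticAt ℝ f (s, n)) :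
    HasDerivAt (fun n => f (s, n)) (_root_.partial₂ f (s, n)) n :=
  hf.differentiableAt.hasDerivAt_partial₂

lemma AnalyticAt.partial_comm {f : ℝ × ℝ → ℝ} {p : ℝ × ℝ} (hf : AnalyticAt ℝ f p) :
    _root_.partial₁ (_root_.partial₂ f) p = _root_.partial₂ (_root_.partial₁ f) p := by
  have hd : DifferentiableAt ℝ (fderiv ℝ f) p := hf.fderiv.differentiableAt
  have key (v w : ℝ × ℝ) :
      fderiv ℝ (fun q => fderiv ℝ f q v) p w = fderiv ℝ (fderiv ℝ f) p w v := by
    have h := ((ContinuousLinearMap.apply ℝ ℝ v).hasFDerivAt (x := fderiv ℝ f p)).comp p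
      hd.hasFDerivAt
    have h' : HasFDerivAt (fun q => fderiv ℝ f q v) _ p := h
    rw [h'.fderiv]
    rfl
  have hs : IsSymmSndFDerivAt ℝ f p :=
    (hf.contDiffAt (n := 2)).isSymmSndFDerivAt (by simp)
  change fderiv ℝ (fun q => fderiv ℝ f q (0, 1)) p (1, 0) =
    fderiv ℝ (fun q => fderiv ℝ f q (1, 0)) p (0, 1)
  rw [key, key]
  exact hs _ _

lemma Filter.EventuallyEq.partial₂ {f g : ℝ × ℝ → ℝ} {p : ℝ × ℝ} (h : f =ᶠ[𝓝 p] g) :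
    _root_.partial₂ f =ᶠ[𝓝 p] _root_.partial₂ g :=
  (Filter.EventuallyEq.fderiv h).fun_comp fun L => L (0, 1)

lemma tendsto_prodMk_left_nhds (s n : ℝ) :
    Filter.Tendsto (fun s : ℝ => (s, n)) (𝓝 s) (𝓝 (s, n)) :=
  (Continuous.prodMk_left n).tendsto s

lemma tendsto_prodMk_right_nhds (s n : ℝ) :
    Filter.Tendsto (fun n : ℝ => (s, n)) (𝓝 n) (𝓝 (s, n)) :=
  (Continuous.prodMk_right s).tendsto n

lemma AnalyticAt.lightFun {f : ℝ × ℝ → ℝ} {p : ℝ × ℝ} (hf : AnalyticAt ℝ f p) :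
    AnalyticAt ℝ (lightFun f) p :=
  (analyticAt_const.sub (hf.partial₁.pow 2)).sub (hf.partial₂.pow 2)

/-- The discriminant `h_t² - 1 - h_x²` of the first fundamental form of a graph `y = h(t, x)`. -/
noncomputable def lightFunTX (h : ℝ × ℝ → ℝ) (q : ℝ × ℝ) : ℝ :=
  partial₁ h q ^ 2 - 1 - partial₂ h q ^ 2

lemma AnalyticAt.lightFunTX {f : ℝ × ℝ → ℝ} {p : ℝ × ℝ} (hf : AnalyticAt ℝ f p) :
    AnalyticAt ℝ (lightFunTX f) p :=
  ((hf.partial₁.pow 2).sub analyticAt_const).sub (hf.partial₂.pow 2)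

/-! ### Causal characters in terms of the light functions -/

lemma firstForm_graphXY {g : ℝ × ℝ → ℝ} {p : ℝ × ℝ} (hg : DifferentiableAt ℝ g p)
    (v w : ℝ × ℝ) :
    firstForm (graphXY g) p v w =
      -((v.1 * partial₁ g p + v.2 * partial₂ g p) * (w.1 * partial₁ g p + w.2 * partial₂ g p))
        + v.1 * w.1 + v.2 * w.2 := by
  have h : HasFDerivAt (graphXY g) _ p := hg.hasFDerivAt.prodMk (hasFDerivAt_id p)
  simp only [firstForm, lorentz, h.fderiv, ContinuousLinearMap.prod_apply,
    fderiv_apply_eq_partial]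
  rfl

lemma firstForm_graphTX {h : ℝ × ℝ → ℝ} {p : ℝ × ℝ} (hh : DifferentiableAt ℝ h p)
    (v w : ℝ × ℝ) :
    firstForm (graphTX h) p v w =
      -(v.1 * w.1) + v.2 * w.2 +
      (v.1 * partial₁ h p + v.2 * partial₂ h p) * (w.1 * partial₁ h p + w.2 * partial₂ h p) := by
  have h : HasFDerivAt (graphTX h) _ p :=
    hasFDerivAt_fst.prodMk (hasFDerivAt_snd.prodMk hh.hasFDerivAt)
  simp only [firstForm, lorentz, h.fderiv, ContinuousLinearMap.prod_apply,
    fderiv_apply_eq_partial]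
  rfl

lemma isLightlikeAt_graphXY_iff {g : ℝ × ℝ → ℝ} {p : ℝ × ℝ} (hg : DifferentiableAt ℝ g p) :
    IsLightlikeAt (graphXY g) p ↔ lightFun g p = 0 := by
  simp only [IsLightlikeAt, firstForm_graphXY hg, lightFun]
  set a := partial₁ g p
  set b := partial₂ g p
  constructor
  · rintro ⟨v, hv, hw⟩
    have h1 := hw (1, 0)
    have h2 := hw (0, 1)
    simp only [one_mul, zero_mul, mul_one, mul_zero, add_zero, zero_add] at h1 h2
    set d := v.1 * a + v.2 * b with hd
    -- Pairing v with the gradient (a, b) gives d · B = 0, and d = 0 would force v = 0.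
    have h3 : d * (1 - a ^ 2 - b ^ 2) = 0 := by
      linear_combination a * h1 + b * h2 + hd
    rcases mul_eq_zero.1 h3 with h | h
    · refine absurd (Prod.ext ?_ ?_) hv
      · simpa [h] using h1
      · simpa [h] using h2
    · exact h
  · intro h
    refine ⟨(a, b), ?_, fun w => ?_⟩
    · intro h0
      have ha : a = 0 := congrArg Prod.fst h0
      have hb : b = 0 := congrArg Prod.snd h0
      simp [ha, hb] at h
    · linear_combination (w.1 * a + w.2 * b) * h

lemma isSpacelikeAt_graphXY {g : ℝ × ℝ → ℝ} {p : ℝ × ℝ} (hg : DifferentiableAt ℝ g p)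
    (h : 0 < lightFun g p) : IsSpacelikeAt (graphXY g) p := by
  intro v hv
  rw [firstForm_graphXY hg]
  unfold lightFun at h
  set a := partial₁ g p
  set b := partial₂ g p
  have hpos : 0 < v.1 ^ 2 + v.2 ^ 2 := by
    by_contra hn
    refine hv (Prod.ext ?_ ?_) <;> simp only [Prod.fst_zero, Prod.snd_zero] <;>
      nlinarith [sq_nonneg v.1, sq_nonneg v.2]
  -- Lagrange's identity: (v₁a + v₂b)² + (v₁b - v₂a)² = |v|²(a² + b²).
  nlinarith [mul_pos hpos h, sq_nonneg (v.1 * b - v.2 * a)]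

lemma isTimelikeAt_graphXY {g : ℝ × ℝ → ℝ} {p : ℝ × ℝ} (hg : DifferentiableAt ℝ g p)
    (h : lightFun g p < 0) : IsTimelikeAt (graphXY g) p := by
  unfold lightFun at h
  -- The form takes the value |∇g|² B on the gradient and |∇g|² on the gradient turned by a right
  -- angle.
  refine ⟨⟨(partial₁ g p, partial₂ g p), ?_⟩, ⟨(-partial₂ g p, partial₁ g p), ?_⟩⟩ <;>
  rw [firstForm_graphXY hg] <;> simp only <;>
  set a := partial₁ g p <;>
  set b := partial₂ g p
  · have : 0 < a ^ 2 + b ^ 2 := by linarith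
    nlinarith [mul_pos this (neg_pos.2 h)]
  · nlinarith

lemma isLightlikeAt_graphTX {h : ℝ × ℝ → ℝ} {p : ℝ × ℝ} (hh : DifferentiableAt ℝ h p)
    (h0 : lightFunTX h p = 0) : IsLightlikeAt (graphTX h) p := by
  unfold lightFunTX at h0
  -- This vector is orthogonal to (0, 1), and its product with w is w.1 times the discriminant.
  refine ⟨(1 + partial₂ h p ^ 2, -(partial₁ h p * partial₂ h p)), fun h' => ?_, fun w => ?_⟩
  · have := congrArg Prod.fst h'
    simp only [Prod.fst_zero] at this
    nlinarith [sq_nonneg (partial₂ h p)]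
  · rw [firstForm_graphTX hh]
    linear_combination w.1 * h0

lemma isSpacelikeAt_graphTX {h : ℝ × ℝ → ℝ} {p : ℝ × ℝ} (hh : DifferentiableAt ℝ h p)
    (h0 : 0 < lightFunTX h p) : IsSpacelikeAt (graphTX h) p := by
  intro v hv
  rw [firstForm_graphTX hh]
  unfold lightFunTX at h0
  set a := partial₁ h p
  set b := partial₂ h p
  have hG : 0 < 1 + b ^ 2 := by positivity
  -- Multiplying by the positive coefficient of v.2² allows completing the square; the remainder is
  -- the discriminant times v.1².
  refine pos_of_mul_pos_right (a := 1 + b ^ 2) ?_ hG.le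
  have : (1 + b ^ 2) * (-(v.1 * v.1) + v.2 * v.2 + (v.1 * a + v.2 * b) * (v.1 * a + v.2 * b)) =
      ((1 + b ^ 2) * v.2 + a * b * v.1) ^ 2 + (a ^ 2 - 1 - b ^ 2) * v.1 ^ 2 := by ring
  rw [this]
  by_cases h1 : v.1 = 0
  · have h2 : v.2 ≠ 0 := fun h2 => hv (Prod.ext h1 h2)
    rw [h1]
    have : (1 + b ^ 2) * v.2 ≠ 0 := mul_ne_zero hG.ne' h2
    have := pow_pos (abs_pos.2 this) 2
    rw [sq_abs] at this
    simpa using this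
  · exact add_pos_of_nonneg_of_pos (sq_nonneg _) (mul_pos h0 (by positivity))

lemma isTimelikeAt_graphTX {h : ℝ × ℝ → ℝ} {p : ℝ × ℝ} (hh : DifferentiableAt ℝ h p)
    (h0 : lightFunTX h p < 0) : IsTimelikeAt (graphTX h) p := by
  unfold lightFunTX at h0
  refine ⟨⟨(1 + partial₂ h p ^ 2, -(partial₁ h p * partial₂ h p)), ?_⟩, ⟨(0, 1), ?_⟩⟩ <;>
  rw [firstForm_graphTX hh]
  · have hG : 0 < 1 + partial₂ h p ^ 2 := by positivity
    simp only
    nlinarith [mul_pos hG (neg_pos.2 h0)]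
  · simp only
    nlinarith [sq_nonneg (partial₂ h p)]

/-! ### The zero mean curvature equation along a line in normal form -/

/-- Uniqueness for a linear system `P' = A P + B v`, `v' = w`, `w' = C P + D v`. -/
lemma eventually_eq_zero_of_linear_ode {P v w A B C D : ℝ → ℝ} {t₀ : ℝ}
    (hA : ContinuousAt A t₀) (hB : ContinuousAt B t₀) (hC : ContinuousAt C t₀)
    (hD : ContinuousAt D t₀)
    (hP : ∀ᶠ t in 𝓝 t₀, HasDerivAt P (A t * P t + B t * v t) t)
    (hv : ∀ᶠ t in 𝓝 t₀, HasDerivAt v (w t) t)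
    (hw : ∀ᶠ t in 𝓝 t₀, HasDerivAt w (C t * P t + D t * v t) t)
    (hP0 : P t₀ = 0) (hv0 : v t₀ = 0) (hw0 : w t₀ = 0) :
    ∀ᶠ t in 𝓝 t₀, P t = 0 ∧ v t = 0 ∧ w t = 0 := by
  have bound {F : ℝ → ℝ} (hF : ContinuousAt F t₀) : ∀ᶠ t in 𝓝 t₀, |F t| ≤ |F t₀| + 1 :=
    (hF.abs.eventually_lt_const (lt_add_one _)).mono fun t ht => ht.le
  -- The coefficient bounds control the first and third components of the field; the final 1 is the
  -- Lipschitz constant of the middle one.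
  set K : ℝ := (|A t₀| + 1) + (|B t₀| + 1) + (|C t₀| + 1) + (|D t₀| + 1) + 1 with hK
  have hK0 : 0 ≤ K := by positivity
  let V : ℝ → ℝ × ℝ × ℝ → ℝ × ℝ × ℝ := fun t y =>
    (A t * y.1 + B t * y.2.1, y.2.2, C t * y.1 + D t * y.2.1)
  have hlip : ∀ᶠ t in 𝓝 t₀, LipschitzOnWith K.toNNReal (V t) Set.univ := by
    filter_upwards [bound hA, bound hB, bound hC, bound hD] with t ha hb hc hd
    refine LipschitzOnWith.of_dist_le_mul fun y _ z _ => ?_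
    rw [Real.coe_toNNReal _ hK0, dist_eq_norm]
    have h1 : |y.1 - z.1| ≤ dist y z := by
      rw [← Real.dist_eq]; exact le_max_left _ _
    have h2 : |y.2.1 - z.2.1| ≤ dist y z := by
      rw [← Real.dist_eq]; exact (le_max_left _ _).trans (le_max_right _ _)
    have h3 : |y.2.2 - z.2.2| ≤ dist y z := by
      rw [← Real.dist_eq]; exact (le_max_right _ _).trans (le_max_right _ _)
    have hpos : 0 ≤ dist y z := dist_nonneg
    have comb {a b α β : ℝ} (ha : |a| ≤ α + 1) (hb : |b| ≤ β + 1) :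
        |(a * y.1 + b * y.2.1) - (a * z.1 + b * z.2.1)| ≤ (α + 1 + (β + 1)) * dist y z := by
      have hα := (abs_nonneg a).trans ha
      have hβ := (abs_nonneg b).trans hb
      calc |(a * y.1 + b * y.2.1) - (a * z.1 + b * z.2.1)|
          = |a * (y.1 - z.1) + b * (y.2.1 - z.2.1)| := by ring_nf
        _ ≤ |a| * |y.1 - z.1| + |b| * |y.2.1 - z.2.1| := by
          rw [← abs_mul, ← abs_mul]; exact abs_add_le _ _
        _ ≤ (α + 1) * dist y z + (β + 1) * dist y z := by gcongr
        _ = _ := by ring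
    have hmono {k : ℝ} (hk : k ≤ K) : k * dist y z ≤ K * dist y z :=
      mul_le_mul_of_nonneg_right hk hpos
    have := abs_nonneg (A t₀)
    have := abs_nonneg (B t₀)
    have := abs_nonneg (C t₀)
    have := abs_nonneg (D t₀)
    refine max_le ?_ (max_le ?_ ?_)
    · exact (comb ha hb).trans (hmono (by rw [hK]; linarith))
    · refine le_trans h3 (le_trans (one_mul _).ge (hmono (by rw [hK]; linarith)))
    · exact (comb hc hd).trans (hmono (by rw [hK]; linarith))
  have := ODE_solution_unique_of_eventually (v := V) (s := fun _ => Set.univ)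
    (f := fun t => (P t, v t, w t)) (g := fun _ => 0) (t₀ := t₀) hlip
    (by
      filter_upwards [hP, hv, hw] with t h1 h2 h3
      exact ⟨h1.prodMk (h2.prodMk h3), trivial⟩)
    (Filter.Eventually.of_forall fun t =>
      ⟨(hasDerivAt_const t (0 : ℝ × ℝ × ℝ)).congr_deriv (by simp [V]; rfl), trivial⟩)
    (by simp [hP0, hv0, hw0])
  filter_upwards [this] with t ht
  simpa [Prod.ext_iff] using ht

/-- The left-hand side of the zero mean curvature equation. -/
noncomputable def zmcOperator (f : ℝ × ℝ → ℝ) (p : ℝ × ℝ) : ℝ :=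
  (1 - partial₂ f p ^ 2) * partial₁ (partial₁ f) p
    + 2 * partial₁ f p * partial₂ f p * partial₂ (partial₁ f) p
    + (1 - partial₁ f p ^ 2) * partial₂ (partial₂ f) p

/-- The derivative of `zmcOperator f` in the second variable. -/
noncomputable def zmcOperatorDeriv (f : ℝ × ℝ → ℝ) (p : ℝ × ℝ) : ℝ :=
  -2 * partial₂ f p * partial₂ (partial₂ f) p * partial₁ (partial₁ f) p
    + (1 - partial₂ f p ^ 2) * partial₂ (partial₁ (partial₁ f)) p
    + 2 * partial₂ f p * partial₂ (partial₁ f) p ^ 2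
    + 2 * partial₁ f p * partial₂ f p * partial₂ (partial₂ (partial₁ f)) p
    + (1 - partial₁ f p ^ 2) * partial₂ (partial₂ (partial₂ f)) p

/-- The two terms in f_s f_nn f_sn cancel, so that every term except (1 - f_n²) f_ssn carries a
factor f_n or 1 - f_s². -/
lemma AnalyticAt.hasDerivAt_zmcOperator {f : ℝ × ℝ → ℝ} {s n : ℝ} (hf : AnalyticAt ℝ f (s, n)) :
    HasDerivAt (fun n => zmcOperator f (s, n)) (zmcOperatorDeriv f (s, n)) n := by
  have h1 := hf.partial₁.hasDerivAt_partial₂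
  have h2 := hf.partial₂.hasDerivAt_partial₂
  have h11 := hf.partial₁.partial₁.hasDerivAt_partial₂
  have h21 := hf.partial₁.partial₂.hasDerivAt_partial₂
  have h22 := hf.partial₂.partial₂.hasDerivAt_partial₂
  have h := ((((h2.pow 2).const_sub 1).mul h11).add (((h1.const_mul 2).mul h2).mul h21)).add
    (((h1.pow 2).const_sub 1).mul h22)
  refine h.congr_deriv ?_
  simp only [zmcOperatorDeriv, Pi.pow_apply, Pi.mul_apply]
  ring

/-- Where f_n, f_sn, f_ss and 1 - f_s² all vanish, as on the lightlike line, only two terms of the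
second n-derivative survive. -/
lemma AnalyticAt.hasDerivAt_zmcOperatorDeriv {f : ℝ × ℝ → ℝ} {s n : ℝ}
    (hf : AnalyticAt ℝ f (s, n)) (h2 : _root_.partial₂ f (s, n) = 0)
    (h1 : _root_.partial₁ f (s, n) ^ 2 = 1)
    (h21 : _root_.partial₂ (_root_.partial₁ f) (s, n) = 0)
    (h11 : _root_.partial₁ (_root_.partial₁ f) (s, n) = 0) :
    HasDerivAt (fun n => zmcOperatorDeriv f (s, n))
      (_root_.partial₂ (_root_.partial₂ (_root_.partial₁ (_root_.partial₁ f))) (s, n) +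
        2 * _root_.partial₁ f (s, n) * _root_.partial₂ (_root_.partial₂ f) (s, n) *
          _root_.partial₂ (_root_.partial₂ (_root_.partial₁ f)) (s, n)) n := by
  have d1 := hf.partial₁.hasDerivAt_partial₂
  have d2 := hf.partial₂.hasDerivAt_partial₂
  have d11 := hf.partial₁.partial₁.hasDerivAt_partial₂
  have d21 := hf.partial₁.partial₂.hasDerivAt_partial₂
  have d22 := hf.partial₂.partial₂.hasDerivAt_partial₂
  have d211 := hf.partial₁.partial₁.partial₂.hasDerivAt_partial₂
  have d221 := hf.partial₁.partial₂.partial₂.hasDerivAt_partial₂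
  have d222 := hf.partial₂.partial₂.partial₂.hasDerivAt_partial₂
  have h := (((((d2.const_mul (-2)).mul d22).mul d11).add (((d2.pow 2).const_sub 1).mul d211)).add
    ((d2.const_mul 2).mul (d21.pow 2)) |>.add (((d1.const_mul 2).mul d2).mul d221)).add
    (((d1.pow 2).const_sub 1).mul d222)
  refine h.congr_deriv ?_
  simp only [Pi.pow_apply, Pi.mul_apply, h2, h21, h11, h1]
  ring

lemma AnalyticAt.hasDerivAt_lightFun {f : ℝ × ℝ → ℝ} {s n : ℝ} (hf : AnalyticAt ℝ f (s, n)) :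
    HasDerivAt (fun n => _root_.lightFun f (s, n))
      (-2 * _root_.partial₁ f (s, n) * _root_.partial₂ (_root_.partial₁ f) (s, n)
        - 2 * _root_.partial₂ f (s, n) * _root_.partial₂ (_root_.partial₂ f) (s, n)) n := by
  have h := ((hf.partial₁.hasDerivAt_partial₂.pow 2).const_sub 1).sub
    (hf.partial₂.hasDerivAt_partial₂.pow 2)
  refine h.congr_deriv ?_
  ring

lemma AnalyticAt.partial₁_partial₂_partial₂ {f : ℝ × ℝ → ℝ} {p : ℝ × ℝ} (hf : AnalyticAt ℝ f p) :
    _root_.partial₁ (_root_.partial₂ (_root_.partial₂ f)) p =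
      _root_.partial₂ (_root_.partial₂ (_root_.partial₁ f)) p := by
  rw [hf.partial₂.partial_comm]
  have h : _root_.partial₁ (_root_.partial₂ f) =ᶠ[𝓝 p] _root_.partial₂ (_root_.partial₁ f) :=
    hf.eventually_analyticAt.mono fun q hq => hq.partial_comm
  exact h.partial₂.eq_of_nhds

/-- A zero mean curvature graph tangent to second order at `o` to a lightlike plane containing
the `x`-direction. -/
structure IsNormalZMCGraph (Ω : Set (ℝ × ℝ)) (f : ℝ × ℝ → ℝ) (σ : ℝ) : Prop where
  isOpen : IsOpen Ω
  zero_mem : (0, 0) ∈ Ω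
  analytic : AnalyticOnNhd ℝ f Ω
  zmc : ∀ p ∈ Ω, zmcOperator f p = 0
  map_zero : f (0, 0) = 0
  sign : σ = 1 ∨ σ = -1
  partial₁_zero : partial₁ f (0, 0) = σ
  partial₂_zero : partial₂ f (0, 0) = 0
  partial₂₁_zero : partial₂ (partial₁ f) (0, 0) = 0

namespace IsNormalZMCGraph

variable {Ω : Set (ℝ × ℝ)} {f : ℝ × ℝ → ℝ} {σ : ℝ}

lemma sq_sign (hf : IsNormalZMCGraph Ω f σ) : σ ^ 2 = 1 := by rcases hf.sign with h | h <;> simp [h]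

lemma zmc_eventually (hf : IsNormalZMCGraph Ω f σ) {p : ℝ × ℝ} (hp : p ∈ Ω) : ∀ᶠ q in 𝓝 p, zmcOperator f q = 0 :=
  Filter.eventually_of_mem (hf.isOpen.mem_nhds hp) hf.zmc

lemma zmcDeriv (hf : IsNormalZMCGraph Ω f σ) {p : ℝ × ℝ} (hp : p ∈ Ω) : zmcOperatorDeriv f p = 0 := by
  obtain ⟨s, n⟩ := p
  have h := (hf.analytic _ hp).hasDerivAt_zmcOperator
  refine h.unique ((hasDerivAt_const n (0 : ℝ)).congr_of_eventuallyEq ?_)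
  exact (tendsto_prodMk_right_nhds s n).eventually (hf.zmc_eventually hp)

lemma eventually_line (hf : IsNormalZMCGraph Ω f σ) : ∀ᶠ s : ℝ in 𝓝 0, partial₁ f (s, 0) = σ ∧ partial₂ f (s, 0) = 0 := by
  have hnear : ∀ᶠ s : ℝ in 𝓝 0, (s, (0 : ℝ)) ∈ Ω :=
    (tendsto_prodMk_left_nhds 0 0).eventually (hf.isOpen.mem_nhds hf.zero_mem)
  have cont {F : ℝ × ℝ → ℝ} (hF : AnalyticAt ℝ F (0, 0)) : ContinuousAt (fun s => F (s, 0)) 0 :=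
    hF.continuousAt.comp (f := fun s : ℝ => (s, (0 : ℝ))) (tendsto_prodMk_left_nhds 0 0)
  have h0 := hf.analytic _ hf.zero_mem
  have c1 := cont h0.partial₁
  have c2 := cont h0.partial₂
  have c11 := cont h0.partial₁.partial₁
  have c21 := cont h0.partial₁.partial₂
  have c22 := cont h0.partial₂.partial₂
  have c221 := cont h0.partial₁.partial₂.partial₂
  have c222 := cont h0.partial₂.partial₂.partial₂
  -- Inverse of 1 - f_n², the coefficient of f_ss in the equation and of f_ssn in its n-derivative.
  -- It is finite near o since f_n(o) = 0.
  set e : ℝ → ℝ := fun s => (1 - partial₂ f (s, 0) ^ 2)⁻¹ with he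
  have ce : ContinuousAt e 0 :=
    (continuousAt_const.sub (c2.pow 2)).inv₀ (by simp [hf.partial₂_zero])
  have hne : ∀ᶠ s : ℝ in 𝓝 0, 1 - partial₂ f (s, 0) ^ 2 ≠ 0 :=
    (continuousAt_const.sub (c2.pow 2)).eventually_ne (by simp [hf.partial₂_zero])
  -- The ODE yields only f_s² = 1; continuity at o then excludes the value -σ.
  have hσ : partial₁ f (0, 0) ≠ -σ := by
    rw [hf.partial₁_zero]
    rcases hf.sign with h | h <;> rw [h] <;> norm_num
  have key := eventually_eq_zero_of_linear_ode (t₀ := 0)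
    (P := fun s => 1 - partial₁ f (s, 0) ^ 2) (v := fun s => partial₂ f (s, 0))
    (w := fun s => partial₂ (partial₁ f) (s, 0))
    (A := fun s => 2 * partial₁ f (s, 0) * e s * partial₂ (partial₂ f) (s, 0))
    (B := fun s => 4 * partial₁ f (s, 0) ^ 2 * e s * partial₂ (partial₁ f) (s, 0))
    (C := fun s => - e s * partial₂ (partial₂ (partial₂ f)) (s, 0))
    (D := fun s => e s * (2 * partial₂ (partial₂ f) (s, 0) * partial₁ (partial₁ f) (s, 0)
      - 2 * partial₂ (partial₁ f) (s, 0) ^ 2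
      - 2 * partial₁ f (s, 0) * partial₂ (partial₂ (partial₁ f)) (s, 0)))
    (((continuousAt_const.mul c1).mul ce).mul c22)
    (((continuousAt_const.mul (c1.pow 2)).mul ce).mul c21)
    (ce.neg.mul c222)
    (ce.mul ((((continuousAt_const.mul c22).mul c11).sub (continuousAt_const.mul (c21.pow 2))).sub
      ((continuousAt_const.mul c1).mul c221)))
    ?_ ?_ ?_ ?_ hf.partial₂_zero hf.partial₂₁_zero
  · filter_upwards [key, c1.eventually_ne hσ] with s hs hsσ
    · refine ⟨?_, hs.2.1⟩
      have h1 : (partial₁ f (s, 0) - σ) * (partial₁ f (s, 0) + σ) = 0 := by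
        linear_combination -hs.1 - hf.sq_sign
      rcases mul_eq_zero.1 h1 with h | h
      · linarith
      · exact absurd (by linarith) hsσ
  · filter_upwards [hnear, hne] with s hs hn
    have h := ((hf.analytic _ hs).partial₁.hasDerivAt_partial₁.pow 2).const_sub 1
    refine h.congr_deriv ?_
    have hz := hf.zmc _ hs
    unfold zmcOperator at hz
    have h11 : partial₁ (partial₁ f) (s, 0) = e s * (-2 * partial₁ f (s, 0) * partial₂ f (s, 0)
        * partial₂ (partial₁ f) (s, 0) - (1 - partial₁ f (s, 0) ^ 2) *
          partial₂ (partial₂ f) (s, 0)) := by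
      rw [he]
      field_simp
      linear_combination hz
    rw [h11]
    ring
  · filter_upwards [hnear] with s hs
    rw [← (hf.analytic _ hs).partial_comm]
    exact (hf.analytic _ hs).partial₂.hasDerivAt_partial₁
  · filter_upwards [hnear, hne] with s hs hn
    refine (hf.analytic _ hs).partial₁.partial₂.hasDerivAt_partial₁.congr_deriv ?_
    have hz := hf.zmcDeriv hs
    unfold zmcOperatorDeriv at hz
    rw [(hf.analytic _ hs).partial₁.partial_comm, he]
    field_simp
    linear_combination hz
  · simp [hf.partial₁_zero, hf.sq_sign]

end IsNormalZMCGraph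

/-! ### Analytic continuation along the line -/

lemma AnalyticAt.comp_prodMk_left {F : ℝ × ℝ → ℝ} {s n : ℝ} (hF : AnalyticAt ℝ F (s, n)) :
    AnalyticAt ℝ (fun s => F (s, n)) s :=
  AnalyticAt.comp (f := fun s : ℝ => (s, n)) hF (analyticAt_id.prod analyticAt_const)

lemma IsIntervalAroundZero.eq_const {J : Set ℝ} (hJ : IsIntervalAroundZero J) {F : ℝ × ℝ → ℝ}
    {c : ℝ} (hF : ∀ s ∈ J, AnalyticAt ℝ F (s, 0)) (h0 : ∀ᶠ s : ℝ in 𝓝 0, F (s, 0) = c) :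
    ∀ s ∈ J, F (s, 0) = c :=
  AnalyticOnNhd.eqOn_of_preconnected_of_eventuallyEq (𝕜 := ℝ) (f := fun s => F (s, 0))
    (g := fun _ => c) (fun s hs => (hF s hs).comp_prodMk_left) (fun _ _ => analyticAt_const)
    hJ.2.1 hJ.2.2 h0

lemma IsIntervalAroundZero.eq_of_hasDerivAt_zero {J : Set ℝ} (hJ : IsIntervalAroundZero J)
    {u : ℝ → ℝ} (hu : ∀ s ∈ J, HasDerivAt u 0 s) : ∀ s ∈ J, u s = u 0 := fun _ hs =>
  hJ.1.is_const_of_deriv_eq_zero hJ.2.1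
    (fun t ht => (hu t ht).differentiableAt.differentiableWithinAt)
    (fun t ht => (hu t ht).deriv) hs hJ.2.2

lemma IsIntervalAroundZero.eq_mul {J : Set ℝ} (hJ : IsIntervalAroundZero J) {F : ℝ × ℝ → ℝ}
    {c : ℝ} (hF : ∀ s ∈ J, AnalyticAt ℝ F (s, 0)) (h0 : F (0, 0) = 0)
    (h1 : ∀ s ∈ J, partial₁ F (s, 0) = c) : ∀ s ∈ J, F (s, 0) = c * s := by
  intro s hs
  have := hJ.eq_of_hasDerivAt_zero (u := fun s => F (s, 0) - c * s) (fun t ht => by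
    refine ((hF t ht).hasDerivAt_partial₁.sub ((hasDerivAt_id t).const_mul c)).congr_deriv ?_
    rw [h1 t ht]; ring) s hs
  simp only [h0] at this
  linarith

lemma IsIntervalAroundZero.partial₁_eq_zero {J : Set ℝ} (hJ : IsIntervalAroundZero J)
    {F : ℝ × ℝ → ℝ} {c : ℝ} (hF : ∀ s ∈ J, AnalyticAt ℝ F (s, 0)) (h : ∀ s ∈ J, F (s, 0) = c) :
    ∀ s ∈ J, partial₁ F (s, 0) = 0 := fun s hs =>
  (hF s hs).hasDerivAt_partial₁.unique ((hasDerivAt_const s c).congr_of_eventuallyEq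
    (Filter.eventually_of_mem (hJ.1.mem_nhds hs) h))

/-- The Riccati equation `α' + α² = 0` has only the solutions `0` and `1 / (s + c)`. -/
lemma IsIntervalAroundZero.isTypeZero_of_riccati {J : Set ℝ} (hJ : IsIntervalAroundZero J)
    {α : ℝ → ℝ} (hα : ∀ s ∈ J, AnalyticAt ℝ α s) (h : ∀ s ∈ J, HasDerivAt α (-α s ^ 2) s) :
    IsTypeZeroI J α ∨ IsTypeZeroII J α := by
  by_cases hz : ∃ s ∈ J, α s = 0
  -- Read as α' = (-α)α, the equation is linear with continuous coefficient -α; a single zero forces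
  -- α to vanish nearby, hence on J by analyticity.
  · obtain ⟨s₀, hs₀, h0⟩ := hz
    left
    have := eventually_eq_zero_of_linear_ode (t₀ := s₀) (P := α) (v := fun _ => 0)
      (w := fun _ => 0) (A := fun s => -α s) (B := fun _ => 0) (C := fun _ => 0)
      (D := fun _ => 0) (hα s₀ hs₀).continuousAt.neg continuousAt_const continuousAt_const
      continuousAt_const
      (Filter.eventually_of_mem (hJ.1.mem_nhds hs₀) fun s hs =>
        (h s hs).congr_deriv (by ring))
      (Filter.Eventually.of_forall fun s => hasDerivAt_const s 0)
      (Filter.Eventually.of_forall fun s => (hasDerivAt_const s 0).congr_deriv (by simp))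
      h0 rfl rfl
    exact AnalyticOnNhd.eqOn_of_preconnected_of_eventuallyEq (𝕜 := ℝ) (g := fun _ => 0) hα
      (fun _ _ => analyticAt_const) hJ.2.1 hs₀ (this.mono fun s hs => hs.1)
  · push Not at hz
    right
    -- Where α has no zero, (1/α)' = 1; the constant c is therefore 1/α(0).
    have key := hJ.eq_of_hasDerivAt_zero (u := fun s => (α s)⁻¹ - s) (fun s hs => by
      refine (((h s hs).inv (hz s hs)).sub (hasDerivAt_id s)).congr_deriv ?_
      have := hz s hs
      field_simp
      ring)
    refine ⟨(α 0)⁻¹, inv_ne_zero (hz 0 hJ.2.2), fun s hs => ?_⟩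
    have : s + (α 0)⁻¹ = (α s)⁻¹ := by
      have := key s hs
      simp only [sub_zero] at this
      linarith
    rw [this]
    exact ⟨inv_ne_zero (hz s hs), (inv_inv _).symm⟩

/-! ### The light function to second order along the lightlike line -/

namespace IsNormalZMCGraph

variable {Ω : Set (ℝ × ℝ)} {f : ℝ × ℝ → ℝ} {σ : ℝ} {J : Set ℝ}

lemma partial₁_line (hf : IsNormalZMCGraph Ω f σ) (hJ : IsIntervalAroundZero J)
    (hJΩ : ∀ s ∈ J, (s, 0) ∈ Ω) : ∀ s ∈ J, partial₁ f (s, 0) = σ :=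
  hJ.eq_const (fun s hs => (hf.analytic _ (hJΩ s hs)).partial₁)
    (hf.eventually_line.mono fun _ h => h.1)

lemma partial₂_line (hf : IsNormalZMCGraph Ω f σ) (hJ : IsIntervalAroundZero J)
    (hJΩ : ∀ s ∈ J, (s, 0) ∈ Ω) : ∀ s ∈ J, partial₂ f (s, 0) = 0 :=
  hJ.eq_const (fun s hs => (hf.analytic _ (hJΩ s hs)).partial₂)
    (hf.eventually_line.mono fun _ h => h.2)

lemma map_line (hf : IsNormalZMCGraph Ω f σ) (hJ : IsIntervalAroundZero J)
    (hJΩ : ∀ s ∈ J, (s, 0) ∈ Ω) : ∀ s ∈ J, f (s, 0) = σ * s :=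
  hJ.eq_mul (fun s hs => hf.analytic _ (hJΩ s hs)) hf.map_zero (hf.partial₁_line hJ hJΩ)

lemma partial₂₁_line (hf : IsNormalZMCGraph Ω f σ) (hJ : IsIntervalAroundZero J)
    (hJΩ : ∀ s ∈ J, (s, 0) ∈ Ω) (s : ℝ) (hs : s ∈ J) : partial₂ (partial₁ f) (s, 0) = 0 := by
  rw [← (hf.analytic _ (hJΩ s hs)).partial_comm]
  exact hJ.partial₁_eq_zero (fun s hs => (hf.analytic _ (hJΩ s hs)).partial₂)
    (hf.partial₂_line hJ hJΩ) s hs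

lemma lightFun_line (hf : IsNormalZMCGraph Ω f σ) (hJ : IsIntervalAroundZero J)
    (hJΩ : ∀ s ∈ J, (s, 0) ∈ Ω) (s : ℝ) (hs : s ∈ J) : lightFun f (s, 0) = 0 := by
  simp [lightFun, hf.partial₁_line hJ hJΩ s hs, hf.partial₂_line hJ hJΩ s hs, hf.sq_sign]

lemma partial₂_lightFun_line (hf : IsNormalZMCGraph Ω f σ) (hJ : IsIntervalAroundZero J)
    (hJΩ : ∀ s ∈ J, (s, 0) ∈ Ω) (s : ℝ) (hs : s ∈ J) : partial₂ (lightFun f) (s, 0) = 0 := by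
  have ha := hf.analytic _ (hJΩ s hs)
  rw [ha.lightFun.hasDerivAt_partial₂.unique ha.hasDerivAt_lightFun]
  simp [hf.partial₂_line hJ hJΩ s hs, hf.partial₂₁_line hJ hJΩ s hs]

/-- In terms of α = σ f_nn the right-hand side is -2(α' + α²), because f_snn is the derivative of
f_nn along the line and σ² = 1. -/
lemma partial₂₂_lightFun_line (hf : IsNormalZMCGraph Ω f σ) (hJ : IsIntervalAroundZero J)
    (hJΩ : ∀ s ∈ J, (s, 0) ∈ Ω) (s : ℝ) (hs : s ∈ J) :
    partial₂ (partial₂ (lightFun f)) (s, 0) =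
      -2 * σ * partial₂ (partial₂ (partial₁ f)) (s, 0) - 2 * partial₂ (partial₂ f) (s, 0) ^ 2 := by
  have ha := hf.analytic _ (hJΩ s hs)
  have d1 := ha.partial₁.hasDerivAt_partial₂
  have d2 := ha.partial₂.hasDerivAt_partial₂
  have d21 := ha.partial₁.partial₂.hasDerivAt_partial₂
  have d22 := ha.partial₂.partial₂.hasDerivAt_partial₂
  have h := ((d1.const_mul (-2)).mul d21).sub ((d2.const_mul 2).mul d22)
  have h' : HasDerivAt (fun n => partial₂ (lightFun f) (s, n)) _ 0 := h.congr_of_eventuallyEq <| by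
    filter_upwards [(tendsto_prodMk_right_nhds s 0).eventually ha.eventually_analyticAt] with n hn
    exact hn.lightFun.hasDerivAt_partial₂.unique hn.hasDerivAt_lightFun
  rw [ha.lightFun.partial₂.hasDerivAt_partial₂.unique h', hf.partial₁_line hJ hJΩ s hs,
    hf.partial₂_line hJ hJΩ s hs, hf.partial₂₁_line hJ hJΩ s hs]
  ring

lemma hasDerivAt_partial₂₂_line (hf : IsNormalZMCGraph Ω f σ) (hJΩ : ∀ s ∈ J, (s, 0) ∈ Ω)
    (s : ℝ) (hs : s ∈ J) :
    HasDerivAt (fun s => partial₂ (partial₂ f) (s, 0)) (partial₂ (partial₂ (partial₁ f)) (s, 0))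
      s := by
  have ha := hf.analytic _ (hJΩ s hs)
  rw [← ha.partial₁_partial₂_partial₂]
  exact ha.partial₂.partial₂.hasDerivAt_partial₁

/-- This is the second n-derivative of the zero mean curvature equation on the line; multiplied by σ
it reads α'' = -2αα'. -/
lemma partial₂₂₁₁_line (hf : IsNormalZMCGraph Ω f σ) (hJ : IsIntervalAroundZero J)
    (hJΩ : ∀ s ∈ J, (s, 0) ∈ Ω) (s : ℝ) (hs : s ∈ J) :
    partial₂ (partial₂ (partial₁ (partial₁ f))) (s, 0) =
      -2 * σ * partial₂ (partial₂ f) (s, 0) * partial₂ (partial₂ (partial₁ f)) (s, 0) := by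
  have ha := hf.analytic _ (hJΩ s hs)
  have h1 := hf.partial₁_line hJ hJΩ s hs
  have h := ha.hasDerivAt_zmcOperatorDeriv (hf.partial₂_line hJ hJΩ s hs)
    (by rw [h1, hf.sq_sign]) (hf.partial₂₁_line hJ hJΩ s hs)
    (hJ.partial₁_eq_zero (fun s hs => (hf.analytic _ (hJΩ s hs)).partial₁)
      (hf.partial₁_line hJ hJΩ) s hs)
  have h0 := h.unique ((hasDerivAt_const (0 : ℝ) (0 : ℝ)).congr_of_eventuallyEq (by
    filter_upwards [(tendsto_prodMk_right_nhds s 0).eventually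
      (hf.isOpen.mem_nhds (hJΩ s hs))] with n hn
    exact hf.zmcDeriv hn))
  rw [h1] at h0
  linear_combination h0

/-- The second normal derivative of `lightFun f` is constant along the line. -/
lemma partial₂₂_lightFun_const (hf : IsNormalZMCGraph Ω f σ) (hJ : IsIntervalAroundZero J)
    (hJΩ : ∀ s ∈ J, (s, 0) ∈ Ω) (s : ℝ) (hs : s ∈ J) :
    partial₂ (partial₂ (lightFun f)) (s, 0) = partial₂ (partial₂ (lightFun f)) (0, 0) := by
  rw [hf.partial₂₂_lightFun_line hJ hJΩ s hs, hf.partial₂₂_lightFun_line hJ hJΩ 0 hJ.2.2]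
  refine hJ.eq_of_hasDerivAt_zero (u := fun s => -2 * σ * partial₂ (partial₂ (partial₁ f)) (s, 0)
    - 2 * partial₂ (partial₂ f) (s, 0) ^ 2) (fun t ht => ?_) s hs
  have ha := hf.analytic _ (hJΩ t ht)
  have d := ha.partial₁.partial₂.partial₂.hasDerivAt_partial₁
  rw [ha.partial₁.partial₁_partial₂_partial₂, hf.partial₂₂₁₁_line hJ hJΩ t ht] at d
  refine ((d.const_mul (-2 * σ)).sub
    (((hf.hasDerivAt_partial₂₂_line hJΩ t ht).pow 2).const_mul 2)).congr_deriv ?_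
  linear_combination 4 * partial₂ (partial₂ f) (t, 0) *
    partial₂ (partial₂ (partial₁ f)) (t, 0) * hf.sq_sign

/-- As B_nn is constant, its vanishing at o gives α' + α² = 0 on all of J. -/
lemma isTypeZero (hf : IsNormalZMCGraph Ω f σ) (hJ : IsIntervalAroundZero J)
    (hJΩ : ∀ s ∈ J, (s, 0) ∈ Ω) (h0 : partial₂ (partial₂ (lightFun f)) (0, 0) = 0) :
    IsTypeZeroI J (approxAlongX f σ) ∨ IsTypeZeroII J (approxAlongX f σ) := by
  refine hJ.isTypeZero_of_riccati (fun s hs => ?_) fun s hs => ?_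
  · exact analyticAt_const.mul (hf.analytic _ (hJΩ s hs)).partial₂.partial₂.comp_prodMk_left
  · refine ((hf.hasDerivAt_partial₂₂_line hJΩ s hs).const_mul σ).congr_deriv ?_
    have h1 := hf.partial₂₂_lightFun_line hJ hJΩ s hs
    rw [hf.partial₂₂_lightFun_const hJ hJΩ s hs, h0] at h1
    simp only [approxAlongX]
    linear_combination h1 / 2 + partial₂ (partial₂ f) (s, 0) ^ 2 * hf.sq_sign

end IsNormalZMCGraph

/-! ### Sign of a function vanishing to second order along a line -/

/-- The mean value theorem applied twice gives D(t, x) = x y D_nn(t, z) with y strictly between 0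
and x, so xy > 0. -/
lemma eventually_pos_of_partial₂₂_pos {D : ℝ × ℝ → ℝ} {s : ℝ} (hD : AnalyticAt ℝ D (s, 0))
    (h0 : ∀ᶠ t : ℝ in 𝓝 s, D (t, 0) = 0) (h1 : ∀ᶠ t : ℝ in 𝓝 s, partial₂ D (t, 0) = 0)
    (h2 : 0 < partial₂ (partial₂ D) (s, 0)) :
    ∀ᶠ p : ℝ × ℝ in 𝓝 (s, 0), p.2 ≠ 0 → 0 < D p := by
  obtain ⟨ε, hε, hball⟩ := Metric.eventually_nhds_iff_ball.1
    (hD.eventually_analyticAt.and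
      (hD.partial₂.partial₂.continuousAt.eventually (lt_mem_nhds h2)))
  have hfst : Filter.Tendsto Prod.fst (𝓝 ((s, 0) : ℝ × ℝ)) (𝓝 s) := continuous_fst.tendsto _
  filter_upwards [Metric.ball_mem_nhds _ hε, hfst.eventually h0, hfst.eventually h1]
  rintro ⟨t, x⟩ hp hD0 hD1 hx
  simp only at hD0 hD1 hx
  rw [← ball_prod_same, Set.mem_prod, Metric.mem_ball, Metric.mem_ball, Real.dist_eq,
    Real.dist_eq, sub_zero] at hp
  have hmem {y : ℝ} (hy : |y| ≤ |x|) : ((t, y) : ℝ × ℝ) ∈ Metric.ball ((s, 0) : ℝ × ℝ) ε := by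
    rw [← ball_prod_same, Set.mem_prod, Metric.mem_ball, Metric.mem_ball, Real.dist_eq,
      Real.dist_eq, sub_zero]
    exact ⟨hp.1, hy.trans_lt hp.2⟩
  have mvt {F : ℝ × ℝ → ℝ} (hF : ∀ p ∈ Metric.ball ((s, 0) : ℝ × ℝ) ε, AnalyticAt ℝ F p)
      (hF0 : F (t, 0) = 0) {y : ℝ} (hy : y ≠ 0) (hyx : |y| ≤ |x|) :
      ∃ z, z ≠ 0 ∧ |z| ≤ |x| ∧ 0 < y * z ∧ F (t, y) = y * partial₂ F (t, z) := by
    have hd (a : ℝ) (ha : |a| ≤ |x|) := (hF _ (hmem ha)).hasDerivAt_partial₂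
    rcases lt_or_gt_of_ne hy with hy0 | hy0
    · have hle (a : ℝ) (h1 : y ≤ a) (h2 : a ≤ 0) : |a| ≤ |x| := by
        rw [abs_of_nonpos h2]; rw [abs_of_neg hy0] at hyx; linarith
      obtain ⟨z, hz, he⟩ := exists_hasDerivAt_eq_slope (fun n => F (t, n))
        (fun n => partial₂ F (t, n)) hy0
        (fun a ha => (hd a (hle a ha.1 ha.2)).continuousAt.continuousWithinAt)
        (fun a ha => hd a (hle a ha.1.le ha.2.le))
      refine ⟨z, hz.2.ne, hle z hz.1.le hz.2.le, mul_pos_of_neg_of_neg hy0 hz.2, ?_⟩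
      rw [he, hF0]
      field_simp
      ring
    · have hle (a : ℝ) (h1 : 0 ≤ a) (h2 : a ≤ y) : |a| ≤ |x| := by
        rw [abs_of_nonneg h1]; rw [abs_of_pos hy0] at hyx; linarith
      obtain ⟨z, hz, he⟩ := exists_hasDerivAt_eq_slope (fun n => F (t, n))
        (fun n => partial₂ F (t, n)) hy0
        (fun a ha => (hd a (hle a ha.1 ha.2)).continuousAt.continuousWithinAt)
        (fun a ha => hd a (hle a ha.1.le ha.2.le))
      refine ⟨z, hz.1.ne', hle z hz.1.le hz.2.le, mul_pos hy0 hz.1, ?_⟩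
      rw [he, hF0]
      field_simp
      ring
  obtain ⟨y, hy, hyx, hxy, e1⟩ := mvt (fun p hp => (hball p hp).1) hD0 hx le_rfl
  obtain ⟨z, -, hzx, -, e2⟩ := mvt (fun p hp => (hball p hp).1.partial₂) hD1 hy hyx
  rw [e1, e2, ← mul_assoc]
  exact mul_pos hxy (hball _ (hmem hzx)).2

lemma IsIntervalAroundZero.nearBothSides {J : Set ℝ} (hJ : IsIntervalAroundZero J)
    {Ω : Set (ℝ × ℝ)} (hΩ : IsOpen Ω) (hJΩ : ∀ s ∈ J, (s, 0) ∈ Ω) {D : ℝ × ℝ → ℝ}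
    (hD : ∀ s ∈ J, AnalyticAt ℝ D (s, 0)) (h0 : ∀ s ∈ J, D (s, 0) = 0)
    (h1 : ∀ s ∈ J, partial₂ D (s, 0) = 0) (h2 : ∀ s ∈ J, 0 < partial₂ (partial₂ D) (s, 0)) :
    NearBothSides Ω (J ×ˢ {0}) (fun p => 0 < D p) := by
  -- The condition `p.1 ∈ J` keeps the neighbourhood from meeting the axis outside the segment, so
  -- that off the segment p.2 ≠ 0.
  have hloc : ∀ s ∈ J, ∃ U, IsOpen U ∧ ((s, 0) : ℝ × ℝ) ∈ U ∧
      ∀ p ∈ U, (p.2 ≠ 0 → 0 < D p) ∧ p ∈ Ω ∧ p.1 ∈ J := by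
    intro s hs
    have hfst : Filter.Tendsto Prod.fst (𝓝 ((s, 0) : ℝ × ℝ)) (𝓝 s) := continuous_fst.tendsto _
    have hev := (eventually_pos_of_partial₂₂_pos (hD s hs)
      (Filter.eventually_of_mem (hJ.1.mem_nhds hs) h0)
      (Filter.eventually_of_mem (hJ.1.mem_nhds hs) h1) (h2 s hs)).and
      ((hΩ.eventually_mem (hJΩ s hs)).and (hfst.eventually (hJ.1.mem_nhds hs)))
    obtain ⟨U, hU, hUo, hsU⟩ := eventually_nhds_iff.1 hev
    exact ⟨U, hUo, hsU, hU⟩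
  choose! U hUo hsU hU using hloc
  refine ⟨⋃ s ∈ J, U s, isOpen_biUnion hUo, ?_, ?_, ?_⟩
  · rintro ⟨s, x⟩ ⟨hs, rfl⟩
    exact Set.mem_biUnion hs (hsU s hs)
  · exact Set.iUnion₂_subset fun s hs p hp => (hU s hs p hp).2.1
  · rintro p ⟨hp, hpS⟩
    obtain ⟨s, hs, hp⟩ := Set.mem_iUnion₂.1 hp
    exact (hU s hs p hp).1 fun h => hpS ⟨(hU s hs p hp).2.2, h⟩

lemma NearBothSides.mono {Ω S : Set (ℝ × ℝ)} {P Q : ℝ × ℝ → Prop} (h : NearBothSides Ω S P)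
    (hPQ : ∀ p ∈ Ω, P p → Q p) : NearBothSides Ω S Q := by
  obtain ⟨U, hU, hSU, hUΩ, hP⟩ := h
  exact ⟨U, hU, hSU, hUΩ, fun p hp => hPQ p (hUΩ hp.1) (hP p hp)⟩

/-! ### Holomorphic extensions and Wick rotations -/

/-- Holomorphic partial derivative in the first variable. -/
noncomputable def cpartial₁ (F : ℂ × ℂ → ℂ) (p : ℂ × ℂ) : ℂ := fderiv ℂ F p (1, 0)

/-- Holomorphic partial derivative in the second variable. -/
noncomputable def cpartial₂ (F : ℂ × ℂ → ℂ) (p : ℂ × ℂ) : ℂ := fderiv ℂ F p (0, 1)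

lemma AnalyticAt.cpartial₁ {F : ℂ × ℂ → ℂ} {p : ℂ × ℂ} (hF : AnalyticAt ℂ F p) :
    AnalyticAt ℂ (cpartial₁ F) p :=
  ((ContinuousLinearMap.apply ℂ ℂ ((1, 0) : ℂ × ℂ)).analyticAt _).comp hF.fderiv

lemma AnalyticAt.cpartial₂ {F : ℂ × ℂ → ℂ} {p : ℂ × ℂ} (hF : AnalyticAt ℂ F p) :
    AnalyticAt ℂ (cpartial₂ F) p :=
  ((ContinuousLinearMap.apply ℂ ℂ ((0, 1) : ℂ × ℂ)).analyticAt _).comp hF.fderiv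

/-- Near the origin, the real function `f` is `c F(a s, b n)`. -/
def IsRotationOf (a b c : ℂ) (F : ℂ × ℂ → ℂ) (f : ℝ × ℝ → ℝ) : Prop :=
  ∀ᶠ q : ℝ × ℝ in 𝓝 (0, 0), (f q : ℂ) = c * F (a * (q.1 : ℂ), b * (q.2 : ℂ))

lemma continuous_rotation (a b : ℂ) :
    Continuous fun q : ℝ × ℝ => (a * (q.1 : ℂ), b * (q.2 : ℂ)) := by fun_prop

lemma eventually_analyticAt_rotation (a b : ℂ) {F : ℂ × ℂ → ℂ} (hF : AnalyticAt ℂ F (0, 0)) :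
    ∀ᶠ q : ℝ × ℝ in 𝓝 (0, 0), AnalyticAt ℂ F (a * (q.1 : ℂ), b * (q.2 : ℂ)) := by
  have h := (continuous_rotation a b).tendsto (0, 0)
  simp only [Complex.ofReal_zero, mul_zero] at h
  exact h.eventually hF.eventually_analyticAt

namespace IsRotationOf

variable {a b c : ℂ} {F : ℂ × ℂ → ℂ} {f : ℝ × ℝ → ℝ}

/-- By the chain rule a derivative only changes the constant c, so rotations can be differentiated
repeatedly. -/
lemma partial₁ (h : IsRotationOf a b c F f) (hF : AnalyticAt ℂ F (0, 0))
    (hf : AnalyticAt ℝ f (0, 0)) :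
    IsRotationOf a b (c * a) (cpartial₁ F) (_root_.partial₁ f) := by
  filter_upwards [h.eventually_nhds, eventually_analyticAt_rotation a b hF,
    hf.eventually_analyticAt] with ⟨s, n⟩ hq hFq hfq
  have h1 := hfq.hasDerivAt_partial₁.ofReal_comp
  have h2 : HasDerivAt (fun s : ℝ => (a * (s : ℂ), b * (n : ℂ))) (a * 1, 0) s :=
    ((hasDerivAt_id s).ofReal_comp.const_mul a).prodMk (hasDerivAt_const s _)
  have h3 := ((hFq.differentiableAt.hasFDerivAt.restrictScalars ℝ).comp_hasDerivAt
    (f := fun s : ℝ => (a * (s : ℂ), b * (n : ℂ))) s h2).const_mul c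
  have h4 := h1.unique (h3.congr_of_eventuallyEq
    ((tendsto_prodMk_left_nhds s n).eventually hq))
  rw [h4]
  have h5 : ((a * 1, 0) : ℂ × ℂ) = a • (1, 0) := by simp
  rw [ContinuousLinearMap.coe_restrictScalars', h5, map_smul, smul_eq_mul, mul_assoc]
  rfl

lemma partial₂ (h : IsRotationOf a b c F f) (hF : AnalyticAt ℂ F (0, 0))
    (hf : AnalyticAt ℝ f (0, 0)) :
    IsRotationOf a b (c * b) (cpartial₂ F) (_root_.partial₂ f) := by
  filter_upwards [h.eventually_nhds, eventually_analyticAt_rotation a b hF,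
    hf.eventually_analyticAt] with ⟨s, n⟩ hq hFq hfq
  have h1 := hfq.hasDerivAt_partial₂.ofReal_comp
  have h2 : HasDerivAt (fun n : ℝ => (a * (s : ℂ), b * (n : ℂ))) (0, b * 1) n :=
    (hasDerivAt_const n _).prodMk ((hasDerivAt_id n).ofReal_comp.const_mul b)
  have h3 := ((hFq.differentiableAt.hasFDerivAt.restrictScalars ℝ).comp_hasDerivAt
    (f := fun n : ℝ => (a * (s : ℂ), b * (n : ℂ))) n h2).const_mul c
  have h4 := h1.unique (h3.congr_of_eventuallyEq
    ((tendsto_prodMk_right_nhds s n).eventually hq))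
  rw [h4]
  have h5 : ((0, b * 1) : ℂ × ℂ) = b • (0, 1) := by simp
  rw [ContinuousLinearMap.coe_restrictScalars', h5, map_smul, smul_eq_mul, mul_assoc]
  rfl

lemma cast_const (h : IsRotationOf a b (1 * 1) F f) : IsRotationOf a b 1 F f := by
  rwa [mul_one] at h

/-- Constant values along the first axis are inherited by rotations. -/
lemma eventually_const {h : ℝ × ℝ → ℝ} {r : ℝ} (hf : IsRotationOf 1 1 1 F f)
    (hF : AnalyticAt ℂ F (0, 0)) (hr : ∀ᶠ s : ℝ in 𝓝 0, f (s, 0) = r)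
    (hh : IsRotationOf a b c F h) : ∀ᶠ t : ℝ in 𝓝 0, (h (t, 0) : ℂ) = c * r := by
  have hφ : AnalyticAt ℂ (fun z : ℂ => F (z, 0)) 0 :=
    AnalyticAt.comp (f := fun z : ℂ => (z, (0 : ℂ))) hF (analyticAt_id.prod analyticAt_const)
  have hreal : ∀ᶠ s : ℝ in 𝓝 0, F ((s : ℂ), 0) = r := by
    filter_upwards [hr, (tendsto_prodMk_left_nhds 0 0).eventually hf] with s h1 h2
    rw [h1] at h2
    simpa using h2.symm
  have htend : Filter.Tendsto (fun s : ℝ => (s : ℂ)) (𝓝[≠] 0) (𝓝[≠] 0) := by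
    refine tendsto_nhdsWithin_iff.2 ⟨?_, ?_⟩
    · have := (Complex.continuous_ofReal.tendsto 0).mono_left
        (nhdsWithin_le_nhds (s := ({0} : Set ℝ)ᶜ))
      simpa using this
    · filter_upwards [self_mem_nhdsWithin] with s hs
      simpa using hs
  -- Nonzero real points accumulate at 0, so the identity theorem extends the value to complex z, in
  -- particular to z = at.
  have hall : ∀ᶠ z : ℂ in 𝓝 0, F (z, 0) = r :=
    (hφ.frequently_eq_iff_eventually_eq analyticAt_const).1
      (htend.frequently (hreal.filter_mono nhdsWithin_le_nhds).frequently)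
  have ht : Filter.Tendsto (fun t : ℝ => a * (t : ℂ)) (𝓝 0) (𝓝 0) := by
    have : Continuous fun t : ℝ => a * (t : ℂ) := by fun_prop
    simpa using this.tendsto 0
  filter_upwards [ht.eventually hall, (tendsto_prodMk_left_nhds 0 0).eventually hh] with t h1 h2
  rw [h2]
  simp only [Complex.ofReal_zero, mul_zero]
  rw [h1]

/-- The holomorphic extension of `1 - f_s² - f_n²`. -/
noncomputable def _root_.clightFun (F : ℂ × ℂ → ℂ) (p : ℂ × ℂ) : ℂ :=
  1 - cpartial₁ F p ^ 2 - cpartial₂ F p ^ 2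

lemma _root_.AnalyticAt.clightFun {F : ℂ × ℂ → ℂ} {p : ℂ × ℂ} (hF : AnalyticAt ℂ F p) :
    AnalyticAt ℂ (clightFun F) p :=
  (analyticAt_const.sub (hF.cpartial₁.pow 2)).sub (hF.cpartial₂.pow 2)

lemma lightFun (h : IsRotationOf 1 1 1 F f) (hF : AnalyticAt ℂ F (0, 0))
    (hf : AnalyticAt ℝ f (0, 0)) : IsRotationOf 1 1 1 (clightFun F) (lightFun f) := by
  filter_upwards [h.partial₁ hF hf, h.partial₂ hF hf] with q h1 h2
  simp only [_root_.lightFun, clightFun, Complex.ofReal_sub, Complex.ofReal_pow, h1, h2]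
  simp

/-- At corresponding points h_t = F_s and h_x² = -F_n², which turns h_t² - 1 - h_x² into -(1 - F_s²
- F_n²). -/
lemma lightFunTX (h : IsRotationOf a b c F f) (hF : AnalyticAt ℂ F (0, 0))
    (hf : AnalyticAt ℝ f (0, 0)) (hca : c * a = 1) (hcb : (c * b) ^ 2 = -1) :
    IsRotationOf a b (-1) (clightFun F) (lightFunTX f) := by
  filter_upwards [h.partial₁ hF hf, h.partial₂ hF hf] with q h1 h2
  simp only [_root_.lightFunTX, clightFun, Complex.ofReal_sub, Complex.ofReal_pow, h1, h2,
    hca, mul_pow, hcb, Complex.ofReal_one]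
  ring

end IsRotationOf

lemma exists_isIntervalAroundZero {Ω : Set (ℝ × ℝ)} (hΩ : IsOpen Ω) (h0 : (0, 0) ∈ Ω) :
    ∃ J : Set ℝ, IsIntervalAroundZero J ∧ ∀ s ∈ J, (s, 0) ∈ Ω := by
  obtain ⟨ε, hε, h⟩ := Metric.eventually_nhds_iff_ball.1
    ((tendsto_prodMk_left_nhds 0 0).eventually (hΩ.mem_nhds h0))
  exact ⟨Metric.ball 0 ε, ⟨Metric.isOpen_ball, (convex_ball _ _).isPreconnected,
    Metric.mem_ball_self hε⟩, h⟩

/-! ### Transfer from the normal form to its rotation -/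

namespace IsNormalZMCGraph

variable {Ω Ω' : Set (ℝ × ℝ)} {f h : ℝ × ℝ → ℝ} {σ ε : ℝ} {J J' : Set ℝ} {F : ℂ × ℂ → ℂ}
  {a b c : ℂ}

lemma rotation_line (hf : IsNormalZMCGraph Ω f σ) (hF : AnalyticAt ℂ F (0, 0))
    (hfF : IsRotationOf 1 1 1 F f) (hhF : IsRotationOf a b c F h) (hca : c * a = 1)
    (hh : AnalyticOnNhd ℝ h Ω') (hJ' : IsIntervalAroundZero J') (hJΩ' : ∀ t ∈ J', (t, 0) ∈ Ω')
    (t : ℝ) (ht : t ∈ J') :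
    h (t, 0) = σ * t ∧ _root_.partial₁ h (t, 0) = σ ∧ _root_.partial₂ h (t, 0) = 0 := by
  have hf0 := hf.analytic _ hf.zero_mem
  have hh0 := hh _ (hJΩ' 0 hJ'.2.2)
  have h1 : ∀ t ∈ J', partial₁ h (t, 0) = σ := by
    refine hJ'.eq_const (fun t ht => (hh _ (hJΩ' t ht)).partial₁) ?_
    refine ((hfF.partial₁ hF hf0).cast_const.eventually_const hF.cpartial₁
      (hf.eventually_line.mono fun _ h => h.1) (hhF.partial₁ hF hh0)).mono fun t ht => ?_
    rw [hca, one_mul] at ht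
    exact_mod_cast ht
  have h2 : ∀ t ∈ J', partial₂ h (t, 0) = 0 := by
    refine hJ'.eq_const (fun t ht => (hh _ (hJΩ' t ht)).partial₂) ?_
    refine ((hfF.partial₂ hF hf0).cast_const.eventually_const hF.cpartial₂
      (hf.eventually_line.mono fun _ h => h.2) (hhF.partial₂ hF hh0)).mono fun t ht => ?_
    rw [Complex.ofReal_zero, mul_zero] at ht
    exact_mod_cast ht
  have hzero : h (0, 0) = 0 := by
    have e1 := hfF.self_of_nhds
    have e2 := hhF.self_of_nhds
    simp only [Complex.ofReal_zero, mul_zero, one_mul, hf.map_zero] at e1 e2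
    rw [← e1, mul_zero] at e2
    exact_mod_cast e2
  exact ⟨hJ'.eq_mul (fun t ht => hh _ (hJΩ' t ht)) hzero h1 t ht, h1 t ht, h2 t ht⟩

lemma rotation_lightFun (hf : IsNormalZMCGraph Ω f σ) (hF : AnalyticAt ℂ F (0, 0))
    (hfF : IsRotationOf 1 1 1 F f) (hhF : IsRotationOf a b c F h) (hca : c * a = 1)
    (hcb : (c * b) ^ 2 = -1) (hb : b ^ 2 = (-ε : ℝ))
    (hh : AnalyticOnNhd ℝ h Ω') (hJ' : IsIntervalAroundZero J') (hJΩ' : ∀ t ∈ J', (t, 0) ∈ Ω')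
    (t : ℝ) (ht : t ∈ J') :
    lightFunTX h (t, 0) = 0 ∧ partial₂ (lightFunTX h) (t, 0) = 0 ∧
      partial₂ (partial₂ (lightFunTX h)) (t, 0) =
        ε * partial₂ (partial₂ (lightFun f)) (0, 0) := by
  obtain ⟨J, hJ, hJΩ⟩ := exists_isIntervalAroundZero hf.isOpen hf.zero_mem
  have hf0 := (hf.analytic _ hf.zero_mem).lightFun
  have hB := hfF.lightFun hF (hf.analytic _ hf.zero_mem)
  have hh0 := (hh _ (hJΩ' 0 hJ'.2.2)).lightFunTX
  have hD := hhF.lightFunTX hF (hh _ (hJΩ' 0 hJ'.2.2)) hca hcb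
  have hBF := hF.clightFun
  have hB2 := (hB.partial₂ hBF hf0).cast_const
  have hD2 := hD.partial₂ hBF hh0
  have hB22 := (hB2.partial₂ hBF.cpartial₂ hf0.partial₂).cast_const
  have hD22 := hD2.partial₂ hBF.cpartial₂ hh0.partial₂
  have near {P : ℝ → Prop} (hP : ∀ s ∈ J, P s) : ∀ᶠ s : ℝ in 𝓝 0, P s :=
    Filter.eventually_of_mem (hJ.1.mem_nhds hJ.2.2) hP
  refine ⟨?_, ?_, ?_⟩
  · refine hJ'.eq_const (fun t ht => (hh _ (hJΩ' t ht)).lightFunTX) ?_ t ht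
    refine (hB.eventually_const hBF (near (hf.lightFun_line hJ hJΩ)) hD).mono fun t ht => ?_
    rw [Complex.ofReal_zero, mul_zero] at ht
    exact_mod_cast ht
  · refine hJ'.eq_const (fun t ht => (hh _ (hJΩ' t ht)).lightFunTX.partial₂) ?_ t ht
    refine (hB2.eventually_const hBF.cpartial₂ (near (hf.partial₂_lightFun_line hJ hJΩ))
      hD2).mono fun t ht => ?_
    rw [Complex.ofReal_zero, mul_zero] at ht
    exact_mod_cast ht
  · refine hJ'.eq_const (fun t ht => (hh _ (hJΩ' t ht)).lightFunTX.partial₂.partial₂) ?_ t ht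
    refine (hB22.eventually_const hBF.cpartial₂.cpartial₂
      (near (hf.partial₂₂_lightFun_const hJ hJΩ)) hD22).mono fun t ht => ?_
    -- The factor -1 comes from the discriminant, and each of the two normal derivatives contributes
    -- a factor b.
    have : (-1 * b * b : ℂ) = (ε : ℝ) := by
      rw [mul_assoc, ← sq, hb]; push_cast; ring
    rw [this] at ht
    exact_mod_cast ht

end IsNormalZMCGraph

/-! ### Complexification of a real analytic function of two variables -/

/-- The standard basis of `ℝ × ℝ`. -/
def stdVec (j : Fin 2) : ℝ × ℝ := if j = 0 then (1, 0) else (0, 1)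

/-- The coordinates on `ℂ × ℂ`. -/
noncomputable def stdCoord (j : Fin 2) : ℂ × ℂ →L[ℂ] ℂ :=
  if j = 0 then ContinuousLinearMap.fst ℂ ℂ ℂ else ContinuousLinearMap.snd ℂ ℂ ℂ

lemma norm_stdVec (j : Fin 2) : ‖stdVec j‖ = 1 := by
  fin_cases j <;> simp [stdVec, Prod.norm_def]

lemma norm_stdCoord_apply_le (j : Fin 2) (z : ℂ × ℂ) : ‖stdCoord j z‖ ≤ ‖z‖ := by
  fin_cases j <;> simp [stdCoord, Prod.norm_def]

/-- The complexification of a multilinear form on `ℝ × ℝ`. -/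
noncomputable def complexifyMultilinear {n : ℕ}
    (p : ContinuousMultilinearMap ℝ (fun _ : Fin n => ℝ × ℝ) ℝ) :
    ContinuousMultilinearMap ℂ (fun _ : Fin n => ℂ × ℂ) ℂ :=
  ∑ e : Fin n → Fin 2, ((p fun i => stdVec (e i) : ℝ) : ℂ) •
    (ContinuousMultilinearMap.mkPiAlgebra ℂ (Fin n) ℂ).compContinuousLinearMap
      fun i => stdCoord (e i)

lemma complexifyMultilinear_apply {n : ℕ}
    (p : ContinuousMultilinearMap ℝ (fun _ : Fin n => ℝ × ℝ) ℝ) (z : Fin n → ℂ × ℂ) :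
    complexifyMultilinear p z = ∑ e : Fin n → Fin 2,
      ((p fun i => stdVec (e i) : ℝ) : ℂ) * ∏ i, stdCoord (e i) (z i) := by
  simp [complexifyMultilinear]

lemma complexifyMultilinear_ofReal {n : ℕ}
    (p : ContinuousMultilinearMap ℝ (fun _ : Fin n => ℝ × ℝ) ℝ) (q : ℝ × ℝ) :
    (complexifyMultilinear p fun _ => ((q.1 : ℂ), (q.2 : ℂ))) = ((p fun _ => q : ℝ) : ℂ) := by
  let x : Fin 2 → ℝ := fun j => if j = 0 then q.1 else q.2
  have hq : q = ∑ j : Fin 2, x j • stdVec j := by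
    ext <;> simp [x, stdVec, Fin.sum_univ_two]
  have hx (j : Fin 2) : stdCoord j ((q.1 : ℂ), (q.2 : ℂ)) = (x j : ℂ) := by
    fin_cases j <;> simp [stdCoord, x]
  conv_rhs => rw [hq]
  rw [complexifyMultilinear_apply, p.map_sum (fun (_ : Fin n) (j : Fin 2) => x j • stdVec j)]
  push_cast
  refine Finset.sum_congr rfl fun e _ => ?_
  rw [p.map_smul_univ (fun i => x (e i)) fun i => stdVec (e i)]
  simp only [hx, smul_eq_mul]
  push_cast
  ring

lemma complexifyMultilinear_conj {n : ℕ}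
    (p : ContinuousMultilinearMap ℝ (fun _ : Fin n => ℝ × ℝ) ℝ) (z : ℂ × ℂ) :
    (complexifyMultilinear p fun _ => (starRingEnd ℂ z.1, starRingEnd ℂ z.2)) =
      starRingEnd ℂ (complexifyMultilinear p fun _ => z) := by
  have hc (j : Fin 2) : stdCoord j (starRingEnd ℂ z.1, starRingEnd ℂ z.2) =
      starRingEnd ℂ (stdCoord j z) := by
    fin_cases j <;> simp [stdCoord]
  simp [complexifyMultilinear_apply, hc]

/-- Each of the 2 ^ n tuples of basis vectors contributes at most ‖p‖. The loss of 2 ^ n merely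
halves the guaranteed radius of convergence. -/
lemma norm_complexifyMultilinear_le {n : ℕ}
    (p : ContinuousMultilinearMap ℝ (fun _ : Fin n => ℝ × ℝ) ℝ) :
    ‖complexifyMultilinear p‖ ≤ 2 ^ n * ‖p‖ := by
  refine ContinuousMultilinearMap.opNorm_le_bound (by positivity) fun z => ?_
  rw [complexifyMultilinear_apply]
  calc _ ≤ ∑ e : Fin n → Fin 2, ‖p‖ * ∏ i, ‖z i‖ := by
        refine norm_sum_le_of_le _ fun e _ => ?_
        rw [norm_mul, norm_prod, Complex.norm_real]
        have h1 : ‖p fun i => stdVec (e i)‖ ≤ ‖p‖ := by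
          simpa [norm_stdVec] using p.le_opNorm fun i => stdVec (e i)
        gcongr
        exact norm_stdCoord_apply_le _ _
    _ = 2 ^ n * ‖p‖ * ∏ i, ‖z i‖ := by
        simp [mul_assoc]

/-- A real analytic function has a holomorphic extension, compatible with conjugation. -/
lemma AnalyticAt.exists_complexification {g : ℝ × ℝ → ℝ} (hg : AnalyticAt ℝ g (0, 0)) :
    ∃ G : ℂ × ℂ → ℂ, AnalyticAt ℂ G (0, 0) ∧
      (∀ᶠ q : ℝ × ℝ in 𝓝 (0, 0), G ((q.1 : ℂ), (q.2 : ℂ)) = (g q : ℂ)) ∧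
      ∀ z : ℂ × ℂ, G (starRingEnd ℂ z.1, starRingEnd ℂ z.2) = starRingEnd ℂ (G z) := by
  obtain ⟨p, r, hp⟩ := hg
  let P : FormalMultilinearSeries ℂ (ℂ × ℂ) ℂ := fun n => complexifyMultilinear (p n)
  obtain ⟨r₀, hr₀, hr₀p⟩ := ENNReal.lt_iff_exists_nnreal_btwn.1 (hp.r_pos.trans_le hp.r_le)
  have hr₀' : 0 < r₀ := by exact_mod_cast hr₀
  obtain ⟨C, -, hC⟩ := p.norm_mul_pow_le_of_lt_radius hr₀p
  have hrad : ((r₀ / 2 : NNReal) : ENNReal) ≤ P.radius := by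
    refine P.le_radius_of_bound C fun n => ?_
    calc ‖P n‖ * ((r₀ / 2 : NNReal) : ℝ) ^ n
        ≤ (2 ^ n * ‖p n‖) * ((r₀ / 2 : NNReal) : ℝ) ^ n := by
          gcongr
          exact norm_complexifyMultilinear_le _
      _ = ‖p n‖ * (r₀ : ℝ) ^ n := by
          push_cast
          rw [div_pow]
          field_simp
      _ ≤ C := hC n
  have hpos : 0 < P.radius :=
    lt_of_lt_of_le (by exact_mod_cast half_pos hr₀') hrad
  refine ⟨P.sum, (P.hasFPowerSeriesOnBall hpos).analyticAt, ?_, fun z => ?_⟩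
  · filter_upwards [Metric.eball_mem_nhds _ hp.r_pos] with q hq
    have h := hp.hasSum (y := q) hq
    have h0 : ((0, 0) : ℝ × ℝ) + q = q := by simp
    rw [h0] at h
    rw [← h.tsum_eq, Complex.ofReal_tsum]
    exact tsum_congr fun n => complexifyMultilinear_ofReal (p n) q
  · simp only [FormalMultilinearSeries.sum]
    rw [Complex.conj_tsum]
    exact tsum_congr fun n => complexifyMultilinear_conj (p n) z

/-- The holomorphic extension can be chosen with the parity of the real function. -/
lemma AnalyticAt.exists_complexification_parity {g : ℝ × ℝ → ℝ} (hg : AnalyticAt ℝ g (0, 0))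
    {τ : ℝ} (hτ : τ ^ 2 = 1) (hpar : ∀ᶠ q : ℝ × ℝ in 𝓝 (0, 0), g (-q.1, q.2) = τ * g q) :
    ∃ G : ℂ × ℂ → ℂ, AnalyticAt ℂ G (0, 0) ∧
      (∀ᶠ q : ℝ × ℝ in 𝓝 (0, 0), G ((q.1 : ℂ), (q.2 : ℂ)) = (g q : ℂ)) ∧
      (∀ z : ℂ × ℂ, G (starRingEnd ℂ z.1, starRingEnd ℂ z.2) = starRingEnd ℂ (G z)) ∧
      ∀ z : ℂ × ℂ, G (-z.1, z.2) = τ * G z := by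
  obtain ⟨G, hG, hGg, hGc⟩ := hg.exists_complexification
  have hτ' : (τ : ℂ) ^ 2 = 1 := by exact_mod_cast hτ
  -- Averaging over the reflection imposes the parity exactly; τ² = 1 and the parity of g keep the
  -- values at real points near o.
  refine ⟨fun z => (G z + τ * G (-z.1, z.2)) / 2, ?_, ?_, fun z => ?_, fun z => ?_⟩
  · refine (hG.add (analyticAt_const.mul ?_)).div_const
    refine AnalyticAt.fun_comp_of_eq (f := fun z : ℂ × ℂ => (-z.1, z.2)) hG
      (analyticAt_fst.neg.prod analyticAt_snd) (by simp)
  · have hneg : Filter.Tendsto (fun q : ℝ × ℝ => (-q.1, q.2)) (𝓝 (0, 0)) (𝓝 (0, 0)) := by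
      have : Continuous fun q : ℝ × ℝ => (-q.1, q.2) := by fun_prop
      simpa using this.tendsto (0, 0)
    filter_upwards [hGg, hneg.eventually hGg, hpar] with q h1 h2 h3
    simp only [Complex.ofReal_neg, h3, Complex.ofReal_mul] at h2
    rw [h1, h2]
    linear_combination (g q : ℂ) / 2 * hτ'
  · have h := hGc (-z.1, z.2)
    simp only [map_neg] at h
    simp only [hGc, h, map_div₀, map_add, map_mul, Complex.conj_ofReal, map_ofNat]
  · simp only [neg_neg, Prod.mk.eta]
    linear_combination -G (-z.1, z.2) / 2 * hτ'

/-- Rotations with real values near the origin come from real analytic functions. -/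
lemma exists_isRotationOf {G : ℂ × ℂ → ℂ} (hG : AnalyticAt ℂ G (0, 0)) {a b c : ℂ}
    (hreal : ∀ s n : ℝ, starRingEnd ℂ (c * G (a * s, b * n)) = c * G (a * s, b * n)) :
    ∃ (Ω' : Set (ℝ × ℝ)) (h : ℝ × ℝ → ℝ), IsOpen Ω' ∧ IsConnected Ω' ∧ (0, 0) ∈ Ω' ∧
      AnalyticOnNhd ℝ h Ω' ∧ IsRotationOf a b c G h := by
  -- Taking the real part gives a real analytic function, and by `hreal` nothing is lost.
  let h : ℝ × ℝ → ℝ := fun q => (c * G (a * (q.1 : ℂ), b * (q.2 : ℂ))).re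
  have hh : AnalyticAt ℝ h (0, 0) := by
    have h1 : AnalyticAt ℝ (fun q : ℝ × ℝ => (a * (q.1 : ℂ), b * (q.2 : ℂ))) (0, 0) :=
      (analyticAt_const.mul ((Complex.ofRealCLM.analyticAt _).comp analyticAt_fst)).prod
        (analyticAt_const.mul ((Complex.ofRealCLM.analyticAt _).comp analyticAt_snd))
    have h2 := AnalyticAt.fun_comp_of_eq (hG.restrictScalars (𝕜 := ℝ)) h1 (by simp)
    exact (Complex.reCLM.analyticAt _).comp (analyticAt_const.mul h2)
  obtain ⟨ε, hε, hball⟩ := Metric.eventually_nhds_iff_ball.1 hh.eventually_analyticAt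
  refine ⟨Metric.ball (0, 0) ε, h, Metric.isOpen_ball,
    ⟨⟨_, Metric.mem_ball_self hε⟩, (convex_ball _ _).isPreconnected⟩,
    Metric.mem_ball_self hε, hball, Filter.Eventually.of_forall fun q => ?_⟩
  exact Complex.conj_eq_iff_re.1 (hreal q.1 q.2)

/-! ### Causal characters on both sides -/

lemma IsIntervalAroundZero.nearBothSides_sign {J : Set ℝ} (hJ : IsIntervalAroundZero J)
    {Ω : Set (ℝ × ℝ)} (hΩ : IsOpen Ω) (hJΩ : ∀ s ∈ J, (s, 0) ∈ Ω) {D : ℝ × ℝ → ℝ} {κ : ℝ}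
    (hD : ∀ s ∈ J, AnalyticAt ℝ D (s, 0)) (h0 : ∀ s ∈ J, D (s, 0) = 0)
    (h1 : ∀ s ∈ J, partial₂ D (s, 0) = 0) (h2 : ∀ s ∈ J, partial₂ (partial₂ D) (s, 0) = κ) :
    (0 < κ → NearBothSides Ω (J ×ˢ {0}) (fun p => 0 < D p)) ∧
      (κ < 0 → NearBothSides Ω (J ×ˢ {0}) (fun p => D p < 0)) := by
  refine ⟨fun hκ => hJ.nearBothSides hΩ hJΩ hD h0 h1 fun s hs => (h2 s hs).symm ▸ hκ,
    fun hκ => ?_⟩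
  have hneg (E : ℝ × ℝ → ℝ) : partial₂ (-E) = -partial₂ E := by
    funext p
    simp [partial₂, fderiv_neg]
  refine (hJ.nearBothSides (D := -D) hΩ hJΩ (fun s hs => (hD s hs).neg) (fun s hs => ?_)
    (fun s hs => ?_) fun s hs => ?_).mono fun p _ hp => ?_
  · simp [h0 s hs]
  · simp [hneg, h1 s hs]
  · simp [hneg, h2 s hs, hκ]
  · simpa using hp

namespace IsNormalZMCGraph

variable {Ω Ω' : Set (ℝ × ℝ)} {f h : ℝ × ℝ → ℝ} {σ ε : ℝ} {J J' : Set ℝ} {F : ℂ × ℂ → ℂ}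
  {a b c : ℂ}

/-- With f_n = 0 at o, B = 0 becomes f_s² = 1, and B_n = -2 f_s f_sn = 0 then gives f_sn = 0. -/
lemma of_lightFun (hΩ : IsOpen Ω) (h0 : (0, 0) ∈ Ω) (hf : AnalyticOnNhd ℝ f Ω)
    (hz : ∀ p ∈ Ω, zmcOperator f p = 0) (hf0 : f (0, 0) = 0) (hl : lightFun f (0, 0) = 0)
    (hl2 : partial₂ (lightFun f) (0, 0) = 0) (h2 : partial₂ f (0, 0) = 0) :
    IsNormalZMCGraph Ω f (partial₁ f (0, 0)) := by
  have hs : partial₁ f (0, 0) ^ 2 = 1 := by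
    simp only [lightFun, h2] at hl
    linarith
  refine ⟨hΩ, h0, hf, hz, hf0, by
    simpa using sq_eq_sq_iff_eq_or_eq_neg.1 (hs.trans (one_pow 2).symm), rfl, h2, ?_⟩
  rw [(hf _ h0).lightFun.hasDerivAt_partial₂.unique (hf _ h0).hasDerivAt_lightFun, h2] at hl2
  have hne : partial₁ f (0, 0) ≠ 0 := fun h => by norm_num [h] at hs
  simpa [hne] using hl2

lemma nearBothSides (hf : IsNormalZMCGraph Ω f σ) (hJ : IsIntervalAroundZero J)
    (hJΩ : ∀ s ∈ J, (s, 0) ∈ Ω) :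
    (0 < partial₂ (partial₂ (lightFun f)) (0, 0) →
      NearBothSides Ω (J ×ˢ {0}) (fun p => 0 < lightFun f p)) ∧
    (partial₂ (partial₂ (lightFun f)) (0, 0) < 0 →
      NearBothSides Ω (J ×ˢ {0}) (fun p => lightFun f p < 0)) :=
  hJ.nearBothSides_sign hf.isOpen hJΩ (fun s hs => (hf.analytic _ (hJΩ s hs)).lightFun)
    (hf.lightFun_line hJ hJΩ) (hf.partial₂_lightFun_line hJ hJΩ)
    (hf.partial₂₂_lightFun_const hJ hJΩ)

lemma rotation_nearBothSides (hf : IsNormalZMCGraph Ω f σ) (hF : AnalyticAt ℂ F (0, 0))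
    (hfF : IsRotationOf 1 1 1 F f) (hhF : IsRotationOf a b c F h) (hca : c * a = 1)
    (hcb : (c * b) ^ 2 = -1) (hb : b ^ 2 = (-ε : ℝ)) (hΩ' : IsOpen Ω')
    (hh : AnalyticOnNhd ℝ h Ω') (hJ' : IsIntervalAroundZero J')
    (hJΩ' : ∀ t ∈ J', (t, 0) ∈ Ω') :
    (0 < ε * partial₂ (partial₂ (lightFun f)) (0, 0) →
      NearBothSides Ω' (J' ×ˢ {0}) (IsSpacelikeAt (graphTX h))) ∧
    (ε * partial₂ (partial₂ (lightFun f)) (0, 0) < 0 →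
      NearBothSides Ω' (J' ×ˢ {0}) (IsTimelikeAt (graphTX h))) := by
  have key := hf.rotation_lightFun hF hfF hhF hca hcb hb hh hJ' hJΩ'
  have := hJ'.nearBothSides_sign hΩ' hJΩ' (fun s hs => (hh _ (hJΩ' s hs)).lightFunTX)
    (fun s hs => (key s hs).1) (fun s hs => (key s hs).2.1) (fun s hs => (key s hs).2.2)
  exact ⟨fun hκ => (this.1 hκ).mono fun p hp => isSpacelikeAt_graphTX (hh p hp).differentiableAt,
    fun hκ => (this.2 hκ).mono fun p hp => isTimelikeAt_graphTX (hh p hp).differentiableAt⟩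

lemma rotation_isLightlikeAt (hf : IsNormalZMCGraph Ω f σ) (hF : AnalyticAt ℂ F (0, 0))
    (hfF : IsRotationOf 1 1 1 F f) (hhF : IsRotationOf a b c F h) (hca : c * a = 1)
    (hh : AnalyticOnNhd ℝ h Ω') (hJ' : IsIntervalAroundZero J') (hJΩ' : ∀ t ∈ J', (t, 0) ∈ Ω')
    (t : ℝ) (ht : t ∈ J') : h (t, 0) = σ * t ∧ IsLightlikeAt (graphTX h) (t, 0) := by
  obtain ⟨h0, h1, h2⟩ := hf.rotation_line hF hfF hhF hca hh hJ' hJΩ' t ht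
  refine ⟨h0, isLightlikeAt_graphTX (hh _ (hJΩ' t ht)).differentiableAt ?_⟩
  simp [_root_.lightFunTX, h1, h2, hf.sq_sign]

end IsNormalZMCGraph

/-! ### Exchanging the coordinates -/

lemma partial₁_comp_swap (f : ℝ × ℝ → ℝ) :
    partial₁ (f ∘ Prod.swap) = partial₂ f ∘ Prod.swap := by
  funext p
  have := (ContinuousLinearEquiv.prodComm ℝ ℝ ℝ).comp_right_fderiv (f := f) (x := p)
  exact congrArg (fun L : ℝ × ℝ →L[ℝ] ℝ => L (1, 0)) this

lemma partial₂_comp_swap (f : ℝ × ℝ → ℝ) :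
    partial₂ (f ∘ Prod.swap) = partial₁ f ∘ Prod.swap := by
  funext p
  have := (ContinuousLinearEquiv.prodComm ℝ ℝ ℝ).comp_right_fderiv (f := f) (x := p)
  exact congrArg (fun L : ℝ × ℝ →L[ℝ] ℝ => L (0, 1)) this

lemma lightFun_comp_swap (f : ℝ × ℝ → ℝ) :
    lightFun (f ∘ Prod.swap) = lightFun f ∘ Prod.swap := by
  funext p
  simp only [lightFun, partial₁_comp_swap, partial₂_comp_swap, Function.comp_apply]
  ring

lemma zmcOperator_comp_swap {f : ℝ × ℝ → ℝ} {p : ℝ × ℝ} (hf : AnalyticAt ℝ f p.swap) :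
    zmcOperator (f ∘ Prod.swap) p = zmcOperator f p.swap := by
  simp only [zmcOperator, partial₁_comp_swap, partial₂_comp_swap, Function.comp_apply,
    hf.partial_comm]
  ring

lemma approxAlongX_comp_swap (f : ℝ × ℝ → ℝ) (σ : ℝ) :
    approxAlongX (f ∘ Prod.swap) σ = approxAlongY f σ := by
  funext s
  simp [approxAlongX, approxAlongY, partial₂_comp_swap]

lemma analyticAt_swap (p : ℝ × ℝ) : AnalyticAt ℝ (Prod.swap : ℝ × ℝ → ℝ × ℝ) p :=
  analyticAt_snd.prod analyticAt_fst

lemma NearBothSides.swap {Ω : Set (ℝ × ℝ)} {J : Set ℝ} {P : ℝ × ℝ → Prop}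
    (h : NearBothSides (Prod.swap ⁻¹' Ω) (J ×ˢ {0}) (P ∘ Prod.swap)) :
    NearBothSides Ω ({0} ×ˢ J) P := by
  obtain ⟨U, hU, hSU, hUΩ, hP⟩ := h
  refine ⟨Prod.swap ⁻¹' U, hU.preimage continuous_swap, ?_, fun p hp => hUΩ hp, ?_⟩
  · rintro ⟨x, y⟩ ⟨hx, hy⟩
    exact hSU ⟨hy, hx⟩
  · rintro ⟨x, y⟩ ⟨hp, hS⟩
    exact hP (y, x) ⟨hp, fun h => hS ⟨h.2, h.1⟩⟩

/-! ### Parity, reduction to normal form and existence of rotations -/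

namespace IsDegenerateZMCGraph

variable {Ω : Set (ℝ × ℝ)} {g : ℝ × ℝ → ℝ}

lemma lightFun_zero (hg : IsDegenerateZMCGraph Ω g) : lightFun g (0, 0) = 0 :=
  (isLightlikeAt_graphXY_iff (hg.analytic _ hg.zero_mem).differentiableAt).1 hg.lightlike

/-- The graph is in normal form if its second partial derivative vanishes at the origin. -/
lemma isNormal (hg : IsDegenerateZMCGraph Ω g) (h : partial₂ g (0, 0) = 0) :
    IsNormalZMCGraph Ω g (partial₁ g (0, 0)) :=
  .of_lightFun hg.isOpen hg.zero_mem hg.analytic hg.zmc hg.map_zero hg.lightFun_zero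
    (by simp [partial₂, hg.grad_eq_zero]) h

lemma isNormal_swap (hg : IsDegenerateZMCGraph Ω g) (h : partial₁ g (0, 0) = 0) :
    IsNormalZMCGraph (Prod.swap ⁻¹' Ω) (g ∘ Prod.swap) (partial₂ g (0, 0)) := by
  have := IsNormalZMCGraph.of_lightFun (f := g ∘ Prod.swap) (hg.isOpen.preimage continuous_swap)
    hg.zero_mem (fun p hp => (hg.analytic _ hp).comp (analyticAt_swap p))
    (fun p hp => (zmcOperator_comp_swap (hg.analytic _ hp)).trans (hg.zmc _ hp)) hg.map_zero
    (by rw [lightFun_comp_swap]; exact hg.lightFun_zero)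
    (by rw [lightFun_comp_swap, partial₂_comp_swap]; simp [partial₁, hg.grad_eq_zero])
    (by rw [partial₂_comp_swap]; exact h)
  rwa [partial₁_comp_swap] at this

lemma eventually_parity (hg : IsDegenerateZMCGraph Ω g) {τ : ℝ}
    (h : ∀ x y : ℝ, (x, y) ∈ Ω → (-x, y) ∈ Ω → g (-x, y) = τ * g (x, y)) :
    ∀ᶠ q : ℝ × ℝ in 𝓝 (0, 0), g (-q.1, q.2) = τ * g q := by
  have hneg : Filter.Tendsto (fun q : ℝ × ℝ => (-q.1, q.2)) (𝓝 (0, 0)) (𝓝 (0, 0)) := by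
    have : Continuous fun q : ℝ × ℝ => (-q.1, q.2) := by fun_prop
    simpa using this.tendsto (0, 0)
  have hΩ := hg.isOpen.eventually_mem hg.zero_mem
  filter_upwards [hΩ, hneg.eventually hΩ] with q h1 h2
  exact h q.1 q.2 h1 h2

lemma partial₁_eq_zero_of_even (hg : IsDegenerateZMCGraph Ω g) (he : IsEvenInX Ω g) :
    partial₁ g (0, 0) = 0 := by
  have hd := (hg.analytic _ hg.zero_mem).hasDerivAt_partial₁
  have hd' : HasDerivAt (fun x : ℝ => g (x, 0)) (partial₁ g (0, 0)) (-0) := by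
    rwa [neg_zero]
  have h1 : HasDerivAt (fun x : ℝ => g (-x, 0)) (partial₁ g (0, 0) * -1) 0 :=
    HasDerivAt.comp (h := fun x : ℝ => -x) 0 hd' (hasDerivAt_neg 0)
  have h2 := (tendsto_prodMk_left_nhds 0 0).eventually
    (hg.eventually_parity (τ := 1) (by simpa [IsEvenInX] using he))
  have := h1.unique (hd.congr_of_eventuallyEq (h2.mono fun x hx => by simpa using hx))
  linarith

/-- Oddness makes g vanish on the y-axis near o. -/
lemma partial₂_eq_zero_of_odd (hg : IsDegenerateZMCGraph Ω g) (ho : IsOddInX Ω g) :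
    partial₂ g (0, 0) = 0 := by
  have hd := (hg.analytic _ hg.zero_mem).hasDerivAt_partial₂
  have h2 := (tendsto_prodMk_right_nhds 0 0).eventually
    (hg.eventually_parity (τ := -1) (by simpa [IsOddInX] using ho))
  refine hd.unique ((hasDerivAt_const 0 (0 : ℝ)).congr_of_eventuallyEq (h2.mono fun y hy => ?_))
  simp only [neg_zero] at hy
  linarith

lemma exists_isEvenWickRotation (hg : IsDegenerateZMCGraph Ω g) (he : IsEvenInX Ω g) :
    ∃ (Ω' : Set (ℝ × ℝ)) (h : ℝ × ℝ → ℝ), IsEvenWickRotation g Ω' h := by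
  obtain ⟨G, hG, hGg, hGc, hGp⟩ :=
    (hg.analytic _ hg.zero_mem).exists_complexification_parity (τ := 1) (by norm_num)
      (hg.eventually_parity (by simpa [IsEvenInX] using he))
  have hF : AnalyticAt ℂ (fun z : ℂ × ℂ => G (z.2, z.1)) (0, 0) :=
    AnalyticAt.comp (f := fun z : ℂ × ℂ => (z.2, z.1)) hG (analyticAt_snd.prod analyticAt_fst)
  obtain ⟨Ω', h, h1, h2, h3, h4, h5⟩ := exists_isRotationOf hF (a := 1) (b := Complex.I) (c := 1)
    (fun s n => by
      -- Reality: conj G(in, s) = G(-in, s) = G(in, s).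
      have e1 := hGc (Complex.I * n, s)
      have e2 := hGp (Complex.I * n, s)
      simp only [map_mul, Complex.conj_I, Complex.conj_ofReal, neg_mul] at e1
      simp only [one_mul]
      rw [← e1, e2, Complex.ofReal_one, one_mul])
  exact ⟨Ω', h, h1, h2, h3, h4, G, hG, hGg, h5.mono fun q hq => by simpa using hq⟩

lemma exists_isOddWickRotation (hg : IsDegenerateZMCGraph Ω g) (ho : IsOddInX Ω g) :
    ∃ (Ω' : Set (ℝ × ℝ)) (h : ℝ × ℝ → ℝ), IsOddWickRotation g Ω' h := by
  obtain ⟨G, hG, hGg, hGc, hGp⟩ :=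
    (hg.analytic _ hg.zero_mem).exists_complexification_parity (τ := -1) (by norm_num)
      (hg.eventually_parity (by simpa [IsOddInX] using ho))
  obtain ⟨Ω', h, h1, h2, h3, h4, h5⟩ := exists_isRotationOf hG (a := Complex.I) (b := 1)
    (c := -Complex.I)
    (fun s n => by
      -- Reality: conj G(is, n) = G(-is, n) = -G(is, n), and this sign cancels the one from conj(-i)
      -- = i.
      have e1 := hGc (Complex.I * s, n)
      have e2 := hGp (Complex.I * s, n)
      simp only [map_mul, Complex.conj_I, Complex.conj_ofReal, neg_mul] at e1
      simp only [map_mul, map_neg, Complex.conj_I, one_mul]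
      rw [← e1, e2]
      push_cast
      ring)
  exact ⟨Ω', h, h1, h2, h3, h4, G, hG, hGg, h5.mono fun q hq => by simpa using hq⟩

end IsDegenerateZMCGraph

theorem corollary4p6 (Ω : Set (ℝ × ℝ)) (g : ℝ × ℝ → ℝ) (hg : IsDegenerateZMCGraph Ω g) :
    -- even case: `h(t, x) = g(ix, t)`, causal characters are preserved
    (IsEvenInX Ω g →
      (∃ (Ω' : Set (ℝ × ℝ)) (h : ℝ × ℝ → ℝ), IsEvenWickRotation g Ω' h) ∧
      ∃ σ : ℝ, (σ = 1 ∨ σ = -1) ∧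
        ∀ J : Set ℝ, IsIntervalAroundZero J → (∀ y ∈ J, (0, y) ∈ Ω) →
          (∀ y ∈ J, g (0, y) = σ * y ∧ IsLightlikeAt (graphXY g) (0, y)) ∧
          ∀ (Ω' : Set (ℝ × ℝ)) (h : ℝ × ℝ → ℝ), IsEvenWickRotation g Ω' h →
          ∀ J' : Set ℝ, IsIntervalAroundZero J' → (∀ t ∈ J', (t, 0) ∈ Ω') →
            (∀ t ∈ J', h (t, 0) = σ * t ∧ IsLightlikeAt (graphTX h) (t, 0)) ∧
            (¬ IsTypeZeroI J (approxAlongY g σ) → ¬ IsTypeZeroII J (approxAlongY g σ) →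
              (NearBothSides Ω ({0} ×ˢ J) (IsSpacelikeAt (graphXY g)) ∧
                NearBothSides Ω' (J' ×ˢ {0}) (IsSpacelikeAt (graphTX h))) ∨
              (NearBothSides Ω ({0} ×ˢ J) (IsTimelikeAt (graphXY g)) ∧
                NearBothSides Ω' (J' ×ˢ {0}) (IsTimelikeAt (graphTX h))))) ∧
    -- odd case: `h(t, x) = -i g(it, x)`, causal characters are reversed
    (IsOddInX Ω g →
      (∃ (Ω' : Set (ℝ × ℝ)) (h : ℝ × ℝ → ℝ), IsOddWickRotation g Ω' h) ∧
      ∃ σ : ℝ, (σ = 1 ∨ σ = -1) ∧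
        ∀ J : Set ℝ, IsIntervalAroundZero J → (∀ x ∈ J, (x, 0) ∈ Ω) →
          (∀ x ∈ J, g (x, 0) = σ * x ∧ IsLightlikeAt (graphXY g) (x, 0)) ∧
          ∀ (Ω' : Set (ℝ × ℝ)) (h : ℝ × ℝ → ℝ), IsOddWickRotation g Ω' h →
          ∀ J' : Set ℝ, IsIntervalAroundZero J' → (∀ t ∈ J', (t, 0) ∈ Ω') →
            (∀ t ∈ J', h (t, 0) = σ * t ∧ IsLightlikeAt (graphTX h) (t, 0)) ∧
            (¬ IsTypeZeroI J (approxAlongX g σ) → ¬ IsTypeZeroII J (approxAlongX g σ) →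
              (NearBothSides Ω (J ×ˢ {0}) (IsSpacelikeAt (graphXY g)) ∧
                NearBothSides Ω' (J' ×ˢ {0}) (IsTimelikeAt (graphTX h))) ∨
              (NearBothSides Ω (J ×ˢ {0}) (IsTimelikeAt (graphXY g)) ∧
                NearBothSides Ω' (J' ×ˢ {0}) (IsSpacelikeAt (graphTX h))))) := by
  refine ⟨fun he => ⟨hg.exists_isEvenWickRotation he, ?_⟩,
    fun ho => ⟨hg.exists_isOddWickRotation ho, ?_⟩⟩
  · have hf := hg.isNormal_swap (hg.partial₁_eq_zero_of_even he)
    refine ⟨partial₂ g (0, 0), hf.sign, fun J hJ hJΩ => ⟨fun y hy => ⟨hf.map_line hJ hJΩ y hy, ?_⟩,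
      ?_⟩⟩
    · rw [isLightlikeAt_graphXY_iff (hg.analytic _ (hJΩ y hy)).differentiableAt]
      have := hf.lightFun_line hJ hJΩ y hy
      rwa [lightFun_comp_swap] at this
    intro Ω' h hh J' hJ' hJΩ'
    obtain ⟨G, hG, hGg, hGh⟩ := hh.rotation
    have hF : AnalyticAt ℂ (fun z : ℂ × ℂ => G (z.2, z.1)) (0, 0) :=
      AnalyticAt.comp (f := fun z : ℂ × ℂ => (z.2, z.1)) hG (analyticAt_snd.prod analyticAt_fst)
    have hfF : IsRotationOf 1 1 1 (fun z : ℂ × ℂ => G (z.2, z.1)) (g ∘ Prod.swap) := by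
      have hsw : Filter.Tendsto (Prod.swap : ℝ × ℝ → ℝ × ℝ) (𝓝 (0, 0)) (𝓝 (0, 0)) :=
        continuous_swap.tendsto (0, 0)
      exact (hsw.eventually hGg).mono fun q hq => by simpa using hq.symm
    have hhF : IsRotationOf 1 Complex.I 1 (fun z : ℂ × ℂ => G (z.2, z.1)) h :=
      hGh.mono fun q hq => by simpa using hq
    refine ⟨hf.rotation_isLightlikeAt hF hfF hhF (by simp) hh.analytic hJ' hJΩ', fun hI hII => ?_⟩
    obtain ⟨hpos, hneg⟩ := hf.nearBothSides hJ hJΩ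
    -- Here b = i, so ε = -b² = 1 and the sign of κ is kept.
    obtain ⟨hpos', hneg'⟩ := hf.rotation_nearBothSides (ε := 1) hF hfF hhF (by simp) (by simp)
      (by simp) hh.isOpen hh.analytic hJ' hJΩ'
    rw [one_mul] at hpos' hneg'
    have hκ : partial₂ (partial₂ (lightFun (g ∘ Prod.swap))) (0, 0) ≠ 0 := fun h0 => by
      have := hf.isTypeZero hJ hJΩ h0
      rw [approxAlongX_comp_swap] at this
      exact this.elim hI hII
    rw [lightFun_comp_swap] at hpos hneg hpos' hneg' hκ
    rcases lt_or_gt_of_ne hκ with h0 | h0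
    · exact Or.inr ⟨(hneg h0).swap.mono fun p hp =>
        isTimelikeAt_graphXY (hg.analytic p hp).differentiableAt, hneg' h0⟩
    · exact Or.inl ⟨(hpos h0).swap.mono fun p hp =>
        isSpacelikeAt_graphXY (hg.analytic p hp).differentiableAt, hpos' h0⟩
  · have hf := hg.isNormal (hg.partial₂_eq_zero_of_odd ho)
    refine ⟨partial₁ g (0, 0), hf.sign, fun J hJ hJΩ => ⟨fun x hx => ⟨hf.map_line hJ hJΩ x hx,
      (isLightlikeAt_graphXY_iff (hg.analytic _ (hJΩ x hx)).differentiableAt).2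
        (hf.lightFun_line hJ hJΩ x hx)⟩, ?_⟩⟩
    intro Ω' h hh J' hJ' hJΩ'
    obtain ⟨G, hG, hGg, hGh⟩ := hh.rotation
    have hfF : IsRotationOf 1 1 1 G g := hGg.mono fun q hq => by simpa using hq.symm
    have hhF : IsRotationOf Complex.I 1 (-Complex.I) G h :=
      hGh.mono fun q hq => by simpa using hq
    refine ⟨hf.rotation_isLightlikeAt hG hfF hhF (by simp) hh.analytic hJ' hJΩ', fun hI hII => ?_⟩
    obtain ⟨hpos, hneg⟩ := hf.nearBothSides hJ hJΩ
    -- Here b = 1, so ε = -b² = -1 and the sign of κ is reversed.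
    obtain ⟨hpos', hneg'⟩ := hf.rotation_nearBothSides (ε := -1) hG hfF hhF (by simp) (by simp)
      (by simp) hh.isOpen hh.analytic hJ' hJΩ'
    have hκ : partial₂ (partial₂ (lightFun g)) (0, 0) ≠ 0 := fun h0 =>
      (hf.isTypeZero hJ hJΩ h0).elim hI hII
    rcases lt_or_gt_of_ne hκ with h0 | h0
    · exact Or.inr ⟨(hneg h0).mono fun p hp =>
        isTimelikeAt_graphXY (hg.analytic p hp).differentiableAt, hpos' (by linarith)⟩
    · exact Or.inl ⟨(hpos h0).mono fun p hp =>
        isSpacelikeAt_graphXY (hg.analytic p hp).differentiableAt, hneg' (by linarith)⟩
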